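/- Let $K\subset S^3$ be the figure-eight knot. Let $M$ be its exterior, that is, the complement of an open tubular neighbourhood of $K$. Let $\alpha,\lambda\in\pi_1(M)$ be the meridian and the longitude of $K$, based at a point of $\partial M$; the longitude is the parallel of $K$ on $\partial M$ that is null-homologous in $M$. Let $M(0)$ be the closed $3$-manifold obtained by $0$-surgery on $K$, that is, by gluing a solid torus $D^2\times S^1$ to $M$ along $\partial M$ so that the circles $\partial D^2\times\{w\}$ are glued to curves parallel to $\lambda$. Then: 1. there is an irreducible representation $\rho:\pi_1(M)\to SL_2(\mathbb{C})$ with $\operatorname{tr}\rho(\alpha)=0$ and $\rho(\lambda)=I$; 2. there is a representation $\rho:\pi_1(M)\to SL_2(\mathbb{C})$ with $\operatorname{tr}\rho(\alpha)=\sqrt5$ and $\rho(\lambda)=I$ whose image is infinite; 3. the group $\pi_1(M(0))$ is non-abelian and infinite. -/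

import Mathlib

/-! ### Knots in the 3-sphere, tubular neighbourhoods, 0-surgery -/

noncomputable section

namespace KnotSurgery

/-- The 3-sphere, as the one-point compactification of Euclidean 3-space. -/
abbrev S3 : Type := OnePoint (EuclideanSpace ℝ (Fin 3))

/-- A parametrized tubular neighbourhood of a knot `K ⊆ S³`: an open embedding of `S¹ × ℂ` into
`S³` that maps the core `S¹ × {0}` onto `K`. The compact solid torus that is removed from `S³` in
a surgery is the image of `S¹ × {‖w‖ ≤ 1}`. -/
structure TubularNbhd (K : Set S3) where
  toFun : Circle × ℂ → S3
  isOpenEmbedding : Topology.IsOpenEmbedding toFun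
  image_core : toFun '' {p | p.2 = 0} = K

variable {K : Set S3}

namespace TubularNbhd

/-- The open solid torus, the image of `S¹ × {‖w‖ < 1}`. -/
def openSolidTorus (N : TubularNbhd K) : Set S3 := N.toFun '' {p | ‖p.2‖ < 1}

/-- The knot exterior: the complement in `S³` of the open solid torus around the knot. -/
abbrev Exterior (N : TubularNbhd K) : Type := {x : S3 // x ∉ N.openSolidTorus}

/-- The parametrization of the boundary torus of the exterior by `S¹ × S¹`: the first coordinate
runs along the knot, the second one around it. -/
def boundary (N : TubularNbhd K) (p : Circle × Circle) : N.Exterior :=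
  ⟨N.toFun (p.1, (p.2 : ℂ)), by
    rintro ⟨q, hq, hqe⟩
    have h := N.isOpenEmbedding.injective hqe
    subst h
    simp [Circle.norm_coe] at hq⟩

theorem continuous_boundary (N : TubularNbhd K) : Continuous N.boundary := by
  refine Continuous.subtype_mk (N.isOpenEmbedding.continuous.comp ?_) _
  fun_prop

/-- The base point, on the boundary torus. -/
def basePoint (N : TubularNbhd K) : N.Exterior := N.boundary (1, 1)

/-- The loop that runs once around the circle `{1} × S¹` of the boundary torus. -/
def meridianLoop (N : TubularNbhd K) : Path N.basePoint N.basePoint where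
  toFun t := N.boundary (1, Circle.exp (2 * Real.pi * t))
  continuous_toFun := N.continuous_boundary.comp (by fun_prop)
  source' := by simp [basePoint]
  target' := by simp [basePoint]

/-- The loop that runs once around the circle `S¹ × {1}` of the boundary torus. -/
def longitudeLoop (N : TubularNbhd K) : Path N.basePoint N.basePoint where
  toFun t := N.boundary (Circle.exp (2 * Real.pi * t), 1)
  continuous_toFun := N.continuous_boundary.comp (by fun_prop)
  source' := by simp [basePoint]
  target' := by simp [basePoint]

/-- The fundamental group of the knot exterior. -/
abbrev knotGroup (N : TubularNbhd K) : Type := FundamentalGroup N.Exterior N.basePoint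

/-- The class of the meridian in the fundamental group of the exterior. -/
def meridian (N : TubularNbhd K) : N.knotGroup :=
  FundamentalGroup.fromPath (Path.Homotopic.Quotient.mk N.meridianLoop)

/-- The class of the parallel `S¹ × {1}` in the fundamental group of the exterior. It is the
longitude of the knot when the parametrization is 0-framed. -/
def longitude (N : TubularNbhd K) : N.knotGroup :=
  FundamentalGroup.fromPath (Path.Homotopic.Quotient.mk N.longitudeLoop)

/-- The parametrization is 0-framed if the parallel `S¹ × {1}` is null-homologous in the exterior,
that is, if its class in `H₁ = (π₁)ᵃᵇ` vanishes. -/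
def IsZeroFramed (N : TubularNbhd K) : Prop := Abelianization.of N.longitude = 1

/-- The solid torus `D² × S¹` that is glued in. -/
abbrev SolidTorus : Type := Metric.closedBall (0 : ℂ) 1 × Circle

/-- The gluing of the new solid torus: its boundary point `(u, w)` is identified with the point
`(u, w)` of the boundary torus of the exterior. So every meridian circle `∂D² × {w}` of the new
solid torus is glued to a parallel `S¹ × {w}` of the knot. -/
inductive SurgeryGlue (N : TubularNbhd K) : N.Exterior ⊕ SolidTorus → N.Exterior ⊕ SolidTorus → Prop
  | glue (u w : Circle) : SurgeryGlue N (Sum.inl (N.boundary (u, w)))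
      (Sum.inr (⟨(u : ℂ), by simp [Circle.norm_coe]⟩, w))

/-- The closed 3-manifold obtained from the exterior by Dehn surgery along the parallel
`S¹ × {1}` (with the quotient topology). For a 0-framed parametrization it is the 0-surgery
`M(0)`. -/
def Surgery (N : TubularNbhd K) : Type := Quot N.SurgeryGlue

instance (N : TubularNbhd K) : TopologicalSpace N.Surgery :=
  inferInstanceAs (TopologicalSpace (Quot N.SurgeryGlue))

end TubularNbhd

/-- The vertices, in cyclic order, of a polygonal figure-eight knot. Edges parallel to the second
axis lie at height `1`, edges parallel to the first axis lie at height `0`. Seen from above (with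
`|` over `=` at each of the four crossings), the projection is the alternating diagram

      5      .===============.
             |               |
      4  .===|=======.       |
         |   |       |       |
      3  |   |   .===|===.   |
         |   |   |   |   |   |
      2  |   .===|===.   |   |
         |       |       |   |
      1  |       .=======|===.
         |               |
      0  .===============.

         0   1   2   3   4   5

where the horizontal strands in rows `4`, `3`, `2`, `1` pass under the vertical strands in
columns `1`, `3`, `2`, `4`, respectively. -/
def figureEightVertex : Fin 24 → EuclideanSpace ℝ (Fin 3) :=
  ![!₂[0, 4, 1], !₂[0, 0, 1], !₂[0, 0, 0], !₂[4, 0, 0],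
    !₂[4, 0, 1], !₂[4, 3, 1], !₂[4, 3, 0], !₂[2, 3, 0],
    !₂[2, 3, 1], !₂[2, 1, 1], !₂[2, 1, 0], !₂[5, 1, 0],
    !₂[5, 1, 1], !₂[5, 5, 1], !₂[5, 5, 0], !₂[1, 5, 0],
    !₂[1, 5, 1], !₂[1, 2, 1], !₂[1, 2, 0], !₂[3, 2, 0],
    !₂[3, 2, 1], !₂[3, 4, 1], !₂[3, 4, 0], !₂[0, 4, 0]]

/-- The figure-eight knot in `S³`, as a closed polygon (indices are taken modulo 24). -/
def figureEightKnot : Set S3 :=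
  (fun x : EuclideanSpace ℝ (Fin 3) => (x : S3)) ''
    ⋃ i : Fin 24, segment ℝ (figureEightVertex i) (figureEightVertex (i + 1))

/-- The linear representation on `ℂ²` given by a homomorphism to `SL₂(ℂ)`. -/
def linearRep {G : Type*} [Group G] (ρ : G →* Matrix.SpecialLinearGroup (Fin 2) ℂ) :
    Representation ℂ G (Fin 2 → ℂ) where
  toFun g := Matrix.toLin' (ρ g : Matrix (Fin 2) (Fin 2) ℂ)
  map_one' := by simp; rfl
  map_mul' g h := by simp [Matrix.toLin'_mul]; rfl

end KnotSurgery

end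

/-! The figure-eight group has two meridian generators a, b and the single relation
b⁻¹a⁻¹ba⁻¹b⁻¹aba⁻¹ba = 1. Only one direction of this presentation is needed: a pair in a group G
that satisfies the relation comes from a homomorphism of the knot group whose image contains
simultaneous conjugates of a and b. Two pairs suffice.

The first lies in the binary dihedral group of order 20 (the knot has determinant 5); meridians go
to elements `xa i`, which are traceless in SL₂(ℂ). The second consists of upper triangular matrices
with diagonal φ, φ⁻¹, where φ is the golden ratio, and corner entries 0 and 1. The relation holds
because φ² is a root of the Alexander polynomial t² - 3t + 1, and the trace is φ + φ⁻¹ = √5. In both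
cases the longitude dies for the same reason: being null-homologous it lies in the kernel of a
character, it commutes with the meridian, and in that kernel only the identity commutes with the
image of the meridian (`quaternion_eq_one`, `Triangular.eq_one_of_commute`). So the second pair also
yields a homomorphism on the group of the surgery, and its image is infinite and non-abelian.

Homomorphisms are built as holonomies of flat bundles rather than from a presentation. The
complement is covered by three charts: off the walls hanging from the overstrands, off the walls
rising from the understrands, and boxes around the crossings. The transition functions are labels of
the cells of the grid diagram, and compatibility at the crossings is the Wirtinger relation
(`knotSystem`). Paths are pushed radially into the exterior (`exists_path_exterior`).

The tubular neighbourhood is an arbitrary topological one, so its meridian has to be recognized: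
tubes around the same point have meridians conjugate to powers of each other, and a test in ℤ forces
the exponent to be ±1 (`isConj_meridianHol`). If the longitude has trivial holonomy, the flat bundle
near the boundary torus depends only on the angle around the knot, and it extends over the glued
solid torus (`surgerySystem`). `exists_hom` collects all of this. -/

open Topology Filter Set
open scoped unitInterval

noncomputable section

namespace KnotSurgery

/-! ### Holonomy -/

/-- A holonomy with values in the group `G`: a homotopy-invariant, multiplicative function on the
paths of `X`. -/
structure Holonomy (X : Type*) [TopologicalSpace X] (G : Type*) [Group G] where
  hol : ∀ {x y : X}, Path x y → G
  hol_trans : ∀ {x y z : X} (p : Path x y) (q : Path y z), hol (p.trans q) = hol q * hol p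
  hol_congr : ∀ {x y : X} {p q : Path x y}, p.Homotopic q → hol p = hol q

namespace Holonomy

variable {X Y : Type*} [TopologicalSpace X] [TopologicalSpace Y] {G : Type*} [Group G]
  (H : Holonomy X G)

theorem hol_refl (x : X) : H.hol (Path.refl x) = 1 := by
  have h := H.hol_trans (Path.refl x) (Path.refl x)
  rw [Path.refl_trans_refl] at h
  exact (mul_eq_left.mp h.symm)

theorem hol_symm {x y : X} (p : Path x y) : H.hol p.symm = (H.hol p)⁻¹ := by
  have h : (p.trans p.symm).Homotopic (Path.refl x) := ⟨(Path.Homotopy.reflTransSymm p).symm⟩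
  have h1 := H.hol_congr h
  rw [H.hol_trans, hol_refl] at h1
  exact eq_inv_of_mul_eq_one_left h1

/-- The homomorphism on the fundamental group given by a holonomy. -/
def toHom (x : X) : FundamentalGroup X x →* G where
  toFun p := Quotient.lift (fun γ : Path x x => H.hol γ) (fun _ _ h => H.hol_congr h) p
  map_one' := H.hol_refl x
  map_mul' p q := by
    induction p using Quotient.inductionOn with | _ p => ?_
    induction q using Quotient.inductionOn with | _ q => ?_
    -- In `FundamentalGroup` the product `p * q` runs along `q` before `p`; this is why `hol_trans`
    -- reverses the factors.
    exact H.hol_trans q p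

theorem toHom_mk {x : X} (p : Path x x) :
    H.toHom x (FundamentalGroup.fromPath (Path.Homotopic.Quotient.mk p)) = H.hol p := rfl

/-- The pull-back of a holonomy along a continuous map. -/
def comap (f : C(Y, X)) : Holonomy Y G where
  hol p := H.hol (p.map f.continuous)
  hol_trans p q := by rw [Path.map_trans, H.hol_trans]
  hol_congr h := H.hol_congr (h.map f)

/-- The development of a holonomy along a map from a simply connected space. -/
def dev [SimplyConnectedSpace Y] (f : C(Y, X)) (u v : Y) : G :=
  (H.comap f).hol (PathConnectedSpace.somePath u v)

section dev

variable [SimplyConnectedSpace Y] (f : C(Y, X))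

theorem dev_eq {u v : Y} (p : Path u v) : H.dev f u v = H.hol (p.map f.continuous) :=
  (H.comap f).hol_congr (SimplyConnectedSpace.paths_homotopic _ _)

/-- The map `f` need not be a covering: one lift of the path is enough to turn its holonomy into a
matter of two endpoints upstairs. -/
theorem hol_eq_dev {x y : X} (p : Path x y) (Γ : C(I, Y)) (h : ∀ t, f (Γ t) = p t) :
    H.hol p = H.dev f (Γ 0) (Γ 1) := by
  obtain rfl : f (Γ 0) = x := (h 0).trans p.source
  obtain rfl : f (Γ 1) = y := (h 1).trans p.target
  rw [H.dev_eq f (⟨Γ, rfl, rfl⟩ : Path (Γ 0) (Γ 1))]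
  congr 1
  ext t
  exact (h t).symm

theorem dev_mul (u v w : Y) : H.dev f v w * H.dev f u v = H.dev f u w := by
  rw [H.dev_eq f (PathConnectedSpace.somePath u v), H.dev_eq f (PathConnectedSpace.somePath v w),
    ← H.hol_trans, ← Path.map_trans, ← H.dev_eq f]

theorem dev_self (u : Y) : H.dev f u u = 1 :=
  mul_eq_left.mp (H.dev_mul f u u u)

theorem dev_inv (u v : Y) : (H.dev f u v)⁻¹ = H.dev f v u :=
  (eq_inv_of_mul_eq_one_left ((H.dev_mul f u v u).trans (H.dev_self f u))).symm

/-- A path and its translate by `T` lie over the same path in `X`. -/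
theorem dev_comp (T : C(Y, Y)) (h : ∀ y, f (T y) = f y) (u v : Y) :
    H.dev f (T u) (T v) = H.dev f u v := by
  obtain ⟨p⟩ : Nonempty (Path u v) := ⟨PathConnectedSpace.somePath u v⟩
  have := H.hol_eq_dev f (p.map f.continuous) (T.comp p.toContinuousMap) (fun t => h _)
  rw [H.dev_eq f p, this]
  simp

/-- The developments of a deck transformation at two points are conjugate. -/
theorem isConj_dev (T : C(Y, Y)) (h : ∀ y, f (T y) = f y) (u v : Y) :
    IsConj (H.dev f u (T u)) (H.dev f v (T v)) := by
  rw [isConj_iff]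
  refine ⟨H.dev f u v, ?_⟩
  rw [dev_inv]
  conv_lhs => rw [← H.dev_comp f T h u v]
  rw [dev_mul, dev_mul]

end dev

end Holonomy

/-! ### Local systems -/

/-- A flat principal bundle with group `G`, given by flat sections `(sec i)⁻¹` over the sets
`U i` of an open cover; they are expressed in a (discontinuous) global trivialization. -/
structure LocalSystem (X : Type*) [TopologicalSpace X] (G : Type*) [Group G] (ι : Type*) where
  U : ι → Set X
  isOpen_U : ∀ i, IsOpen (U i)
  idx : X → ι
  mem_idx : ∀ x, x ∈ U (idx x)
  sec : ι → X → G
  -- Only the transition functions are constrained; a single section may jump.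
  locConst : ∀ i j x, x ∈ U i → x ∈ U j →
    ∀ᶠ y in 𝓝 x, sec j y * (sec i y)⁻¹ = sec j x * (sec i x)⁻¹

namespace LocalSystem

variable {X : Type*} [TopologicalSpace X] {G : Type*} [Group G] {ι : Type*}
  (L : LocalSystem X G ι)

/-- A function along a path that is a parallel section of the flat bundle. -/
def Parallel {T : Type*} [TopologicalSpace T] (γ : T → X) (v : T → G) : Prop :=
  ∀ t, ∃ i, γ t ∈ L.U i ∧ ∀ᶠ s in 𝓝 t, L.sec i (γ s) * v s = L.sec i (γ t) * v t

-- Parallelism is required in one chart only; locally constant transition functions carry it to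
-- every chart around the point.
variable {L} in
theorem Parallel.all {T : Type*} [TopologicalSpace T] {γ : T → X} {v : T → G}
    (h : L.Parallel γ v) (hγ : Continuous γ) {t : T} {j : ι} (hj : γ t ∈ L.U j) :
    ∀ᶠ s in 𝓝 t, L.sec j (γ s) * v s = L.sec j (γ t) * v t := by
  obtain ⟨i, hi, hs⟩ := h t
  filter_upwards [hs, hγ.continuousAt.eventually (L.locConst i j _ hi hj)] with s h1 h2
  have e1 : L.sec j (γ s) * v s = (L.sec j (γ s) * (L.sec i (γ s))⁻¹) * (L.sec i (γ s) * v s) := by group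
  rw [e1, h2, h1]; group

variable {L} in
theorem Parallel.comp {T S : Type*} [TopologicalSpace T] [TopologicalSpace S] {γ : T → X}
    {v : T → G} (h : L.Parallel γ v) {f : S → T} (hf : Continuous f) :
    L.Parallel (γ ∘ f) (v ∘ f) := fun s => by
  obtain ⟨i, hi, hs⟩ := h (f s)
  exact ⟨i, hi, hf.continuousAt.eventually hs⟩

-- In a common chart both functions are constant up to the same section, so `v⁻¹ * w` is locally
-- constant: parallel functions differ by a right translation.
variable {L} in
theorem Parallel.unique {T : Type*} [TopologicalSpace T] [PreconnectedSpace T] {γ : T → X}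
    (hγ : Continuous γ) {v w : T → G} (hv : L.Parallel γ v) (hw : L.Parallel γ w) (s t : T) :
    v s * (v t)⁻¹ = w s * (w t)⁻¹ := by
  have h : IsLocallyConstant fun t => (v t)⁻¹ * w t := by
    rw [IsLocallyConstant.iff_eventually_eq]
    intro t
    obtain ⟨i, hi, hs⟩ := hv t
    filter_upwards [hs, hw.all hγ hi] with s h1 h2
    have e1 : (v s)⁻¹ * w s = (L.sec i (γ s) * v s)⁻¹ * (L.sec i (γ s) * w s) := by group
    rw [e1, h1, h2]; group
  have h2 := h.apply_eq_of_preconnectedSpace s t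
  have h3 : w s = v s * ((v t)⁻¹ * w t) := by rw [← h2]; group
  rw [h3]; group

/-- The fiber bundle of a local system. -/
def core [TopologicalSpace G] [DiscreteTopology G] : FiberBundleCore ι X G where
  baseSet := L.U
  isOpen_baseSet := L.isOpen_U
  indexAt := L.idx
  mem_baseSet_at := L.mem_idx
  coordChange i j x v := L.sec j x * (L.sec i x)⁻¹ * v
  coordChange_self i x _ v := by simp
  continuousOn_coordChange i j := by
    rintro ⟨x, v⟩ ⟨⟨hi, hj⟩, -⟩
    apply ContinuousAt.continuousWithinAt
    have : (fun p : X × G => L.sec j p.1 * (L.sec i p.1)⁻¹ * p.2) =ᶠ[𝓝 (x, v)]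
        fun _ => L.sec j x * (L.sec i x)⁻¹ * v := by
      have h2 : ∀ᶠ p : X × G in 𝓝 (x, v), p.2 = v :=
        (continuous_snd.continuousAt (x := (x, v))).preimage_mem_nhds
          ((isOpen_discrete {v}).mem_nhds rfl)
      filter_upwards [continuous_fst.continuousAt.eventually (L.locConst i j x hi hj), h2]
        with p h1 h2
      rw [h1, h2]
    exact continuousAt_const.congr this.symm
  coordChange_comp i j k x _ v := by group

/-- The parallel coordinate of a point of the bundle. -/
def coord [TopologicalSpace G] [DiscreteTopology G] (e : L.core.TotalSpace) : G :=
  (L.sec (L.idx e.1) e.1)⁻¹ * (show G from e.2)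

theorem parallel_of_lift [TopologicalSpace G] [DiscreteTopology G] {T : Type*}
    [TopologicalSpace T] (Γ : C(T, L.core.TotalSpace)) :
    L.Parallel (fun t => (Γ t).1) (fun t => L.coord (Γ t)) := fun t => by
  refine ⟨L.idx (Γ t).1, L.mem_idx _, ?_⟩
  set i := L.idx (Γ t).1
  have hc : ContinuousAt (fun s => L.core.localTriv i (Γ s)) t :=
    ((L.core.localTriv i).continuousOn_toFun.continuousAt
      ((L.core.localTriv i).open_source.mem_nhds (L.mem_idx _))).comp Γ.continuous.continuousAt
  have h2 : ∀ᶠ s in 𝓝 t, (L.core.localTriv i (Γ s)).2 = (L.core.localTriv i (Γ t)).2 :=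
    (continuous_snd.continuousAt.comp hc).eventually_mem ((isOpen_discrete {_}).mem_nhds rfl)
  have key : ∀ s, (L.core.localTriv i (Γ s)).2 = L.sec i (Γ s).1 * L.coord (Γ s) := fun s => by
    rw [FiberBundleCore.localTriv_apply]
    exact mul_assoc _ _ _
  simpa only [key] using h2

theorem exists_parallel (x y : X) (p : Path x y) : ∃ v : I → G, L.Parallel p v := by
  -- With discrete fibre the bundle `core` is a covering space, so paths lift.
  let _ : TopologicalSpace G := ⊥
  have _ : DiscreteTopology G := ⟨rfl⟩
  have cov : IsCoveringMap (L.core.proj) :=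
    FiberBundle.isCoveringMap (F := G) (E := L.core.Fiber)
  have h := cov.liftPath_lifts p.toContinuousMap ⟨x, (1 : G)⟩ p.source
  have H := L.parallel_of_lift (cov.liftPath p.toContinuousMap ⟨x, (1 : G)⟩ p.source)
  exact ⟨_, by convert H using 1; exact h.symm⟩

/-- Monodromy theorem: lifts of homotopic paths from one starting point end at the same point. -/
theorem exists_parallel_of_homotopic {x y : X} {p q : Path x y} (hpq : p.Homotopic q) :
    ∃ v w : I → G, L.Parallel p v ∧ L.Parallel q w ∧ v 0 = w 0 ∧ v 1 = w 1 := by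
  let _ : TopologicalSpace G := ⊥
  have _ : DiscreteTopology G := ⟨rfl⟩
  have cov : IsCoveringMap (L.core.proj) :=
    FiberBundle.isCoveringMap (F := G) (E := L.core.Fiber)
  have hp := cov.liftPath_lifts p.toContinuousMap ⟨x, (1 : G)⟩ p.source
  have hq := cov.liftPath_lifts q.toContinuousMap ⟨x, (1 : G)⟩ q.source
  have h0 := cov.liftPath_zero p.toContinuousMap ⟨x, (1 : G)⟩ p.source
  have h0' := cov.liftPath_zero q.toContinuousMap ⟨x, (1 : G)⟩ q.source
  have h1 := cov.liftPath_apply_one_eq_of_homotopicRel hpq (⟨x, (1 : G)⟩ : L.core.TotalSpace)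
    p.source q.source
  have Hp := L.parallel_of_lift (cov.liftPath p.toContinuousMap ⟨x, (1 : G)⟩ p.source)
  have Hq := L.parallel_of_lift (cov.liftPath q.toContinuousMap ⟨x, (1 : G)⟩ q.source)
  refine ⟨_, _, by convert Hp using 1; exact hp.symm, by convert Hq using 1; exact hq.symm, ?_, ?_⟩
  · simp only [h0, h0']
  · simp only [h1]

/-- The holonomy of a local system. -/
def holonomy : Holonomy X G where
  hol {x y} p := (L.exists_parallel x y p).choose 1 * ((L.exists_parallel x y p).choose 0)⁻¹
  hol_trans {x y z} p q := by
    have H := (L.exists_parallel x z (p.trans q)).choose_spec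
    set v := (L.exists_parallel x z (p.trans q)).choose
    let f : I → I := fun t => ⟨(t : ℝ) / 2, by constructor <;> linarith [t.2.1, t.2.2]⟩
    let g : I → I := fun t => ⟨((t : ℝ) + 1) / 2, by constructor <;> linarith [t.2.1, t.2.2]⟩
    have hf : Continuous f := by fun_prop
    have hg : Continuous g := by fun_prop
    have e1 : (p.trans q) ∘ f = p := by
      ext t
      have := t.2.2
      simp only [Function.comp, Path.trans_apply, f]
      rw [dif_pos (by linarith)]
      congr 1; ext; simp; ring
    have e2 : (p.trans q) ∘ g = q := by
      ext t
      have := t.2.1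
      simp only [Function.comp, Path.trans_apply, g]
      split_ifs with h
      · have : t = 0 := le_antisymm (show (t : ℝ) ≤ 0 by linarith) this
        subst this; simp
      · congr 1; ext; simp; ring
    have H1 := H.comp hf
    have H2 := H.comp hg
    rw [e1] at H1
    rw [e2] at H2
    rw [Parallel.unique p.continuous (L.exists_parallel x y p).choose_spec H1 1 0,
      Parallel.unique q.continuous (L.exists_parallel y z q).choose_spec H2 1 0]
    have f0 : f 0 = 0 := by ext; simp [f]
    have g1 : g 1 = 1 := by ext; norm_num [g]
    have fg : f 1 = g 0 := by ext; norm_num [f, g]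
    simp only [Function.comp, f0, g1, fg]
    group
  hol_congr {x y p q} h := by
    obtain ⟨v, w, hv, hw, h0, h1⟩ := L.exists_parallel_of_homotopic h
    rw [Parallel.unique p.continuous (L.exists_parallel x y p).choose_spec hv 1 0,
      Parallel.unique q.continuous (L.exists_parallel x y q).choose_spec hw 1 0, h0, h1]

theorem hol_eq_of_parallel {x y : X} (p : Path x y) {v : I → G} (hv : L.Parallel p v) :
    L.holonomy.hol p = v 1 * (v 0)⁻¹ :=
  Parallel.unique p.continuous (L.exists_parallel x y p).choose_spec hv 1 0

theorem exists_parallel_hol {x y : X} (p : Path x y) :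
    ∃ v : I → G, L.Parallel p v ∧ L.holonomy.hol p = v 1 * (v 0)⁻¹ :=
  ⟨_, (L.exists_parallel x y p).choose_spec, rfl⟩

theorem hol_of_forall_mem {x y : X} (p : Path x y) (i : ι) (h : ∀ t, p t ∈ L.U i) :
    L.holonomy.hol p = (L.sec i y)⁻¹ * L.sec i x := by
  rw [L.hol_eq_of_parallel p (v := fun t => (L.sec i (p t))⁻¹)]
  · simp
  · exact fun t => ⟨i, h t, by simp⟩

end LocalSystem

/-! ### The labelled grid diagram of the figure-eight knot -/

/-- The lower end of the `k`-th vertical (and horizontal) segment of the grid diagram. -/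
def gridLo : Fin 6 → ℕ := ![0, 2, 1, 2, 0, 1]

/-- The upper end of the `k`-th vertical (and horizontal) segment of the grid diagram. -/
def gridHi : Fin 6 → ℕ := ![4, 5, 3, 4, 3, 5]

/-- The point `(x, y)` lies on a vertical segment of the grid diagram. -/
def OnColumn (x y : ℝ) : Prop := ∃ k : Fin 6, x = (k : ℕ) ∧ (gridLo k : ℝ) ≤ y ∧ y ≤ gridHi k

/-- The unit segment from `(c, j)` to `(c, j + 1)` lies on a vertical segment of the diagram. -/
def Covered (c j : ℤ) : Prop := ∃ k : Fin 6, c = (k : ℕ) ∧ (gridLo k : ℤ) ≤ j ∧ j < gridHi k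

instance (c j : ℤ) : Decidable (Covered c j) := by unfold Covered; infer_instance

/-- The crossings of the grid diagram. -/
def IsCrossing (c r : ℤ) : Prop :=
  (c = 1 ∧ r = 4) ∨ (c = 3 ∧ r = 3) ∨ (c = 2 ∧ r = 2) ∨ (c = 4 ∧ r = 1)

instance (c r : ℤ) : Decidable (IsCrossing c r) := by unfold IsCrossing; infer_instance

section labels

variable {G : Type*} [Group G] (a b : G)

/-- The labels of the cells, first index the row, second index the column. -/
def cellTable : ℕ → ℕ → G
  | 0, 0 => a | 0, 1 => a | 0, 2 => a | 0, 3 => a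
  | 1, 0 => a | 1, 1 => a | 1, 2 => a * b | 1, 3 => a * b | 1, 4 => b
  | 2, 0 => a | 2, 1 => b * a | 2, 2 => a * b * a⁻¹ * b * a | 2, 3 => a * b | 2, 4 => b
  | 3, 0 => a | 3, 1 => b * a | 3, 2 => b * a | 3, 3 => b | 3, 4 => b
  | 4, 1 => b | 4, 2 => b | 4, 3 => b | 4, 4 => b
  | _, _ => 1

/-- The label of the cell `(i, i + 1) × (j, j + 1)`. -/
def cellLabel (i j : ℤ) : G := if 0 ≤ i ∧ 0 ≤ j then cellTable a b j.toNat i.toNat else 1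

theorem cellLabel_eq_one {i j : ℤ} (h : i < 0 ∨ 4 < i ∨ j < 0 ∨ 4 < j) : cellLabel a b i j = 1 := by
  unfold cellLabel
  split_ifs with h0
  · obtain ⟨m, hm⟩ | ⟨m, hm⟩ : (∃ m, i.toNat = m + 5) ∨ (∃ m, j.toNat = m + 5) := by
      rcases h with h | h | h | h
      · omega
      · exact Or.inl ⟨i.toNat - 5, by omega⟩
      · omega
      · exact Or.inr ⟨j.toNat - 5, by omega⟩
    · rw [hm]
      rcases j.toNat with _ | _ | _ | _ | _ | _ <;> rfl
    · rw [hm]; rfl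
  · rfl

/-- A finite check: two cells separated by an edge without strand belong to the same region of the
diagram. -/
theorem cellLabel_sub_one_left {c j : ℤ} (h : ¬ Covered c j) :
    cellLabel a b (c - 1) j = cellLabel a b c j := by
  by_cases hc : 0 ≤ c ∧ c ≤ 5 ∧ 0 ≤ j ∧ j ≤ 4
  · obtain ⟨h1, h2, h3, h4⟩ := hc
    interval_cases c <;> interval_cases j <;> first | rfl | exact absurd (by decide) h
  · rw [cellLabel_eq_one, cellLabel_eq_one] <;> omega

/-- The diagram is symmetric under exchange of the coordinates, so `Covered` and `OnColumn` with
swapped arguments describe the rows. -/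
theorem cellLabel_sub_one_right {i r : ℤ} (h : ¬ Covered r i) :
    cellLabel a b i (r - 1) = cellLabel a b i r := by
  by_cases hc : 0 ≤ r ∧ r ≤ 5 ∧ 0 ≤ i ∧ i ≤ 4
  · obtain ⟨h1, h2, h3, h4⟩ := hc
    interval_cases r <;> interval_cases i <;> first | rfl | exact absurd (by decide) h
  · rw [cellLabel_eq_one, cellLabel_eq_one] <;> omega

-- Both sides are the holonomy around the overstrand, computed on the two sides of the understrand.
-- Three crossings impose nothing on `a` and `b`; the crossing (3, 3) is the relation `hR`.
variable {a b} in
theorem cellLabel_crossing (hR : b⁻¹ * a⁻¹ * b * a⁻¹ * b⁻¹ * a * b * a⁻¹ * b * a = 1) {c r : ℤ}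
    (h : IsCrossing c r) :
    cellLabel a b c (r - 1) * (cellLabel a b (c - 1) (r - 1))⁻¹ =
      cellLabel a b c r * (cellLabel a b (c - 1) r)⁻¹ := by
  rcases h with ⟨rfl, rfl⟩ | ⟨rfl, rfl⟩ | ⟨rfl, rfl⟩ | ⟨rfl, rfl⟩
  · change b * a * a⁻¹ = b * 1⁻¹
    group
  · change a * b * (a * b * a⁻¹ * b * a)⁻¹ = b * (b * a)⁻¹
    have h2 : a * b * a⁻¹ * b * a = (b⁻¹ * a⁻¹ * b * a⁻¹ * b⁻¹)⁻¹ := by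
      rw [eq_inv_iff_mul_eq_one, mul_eq_one_iff_eq_inv, eq_comm, inv_eq_iff_mul_eq_one, ← hR]
      group
    rw [h2]
    group
  · change a * b * a⁻¹ = a * b * a⁻¹ * b * a * (b * a)⁻¹
    group
  · change 1 * a⁻¹ = b * (a * b)⁻¹
    group

end labels

theorem eventually_floor (x : ℝ) :
    ∀ᶠ x' in 𝓝 x, ⌊x'⌋ = ⌊x⌋ ∨ (⌊x'⌋ = ⌊x⌋ - 1 ∧ x = ⌊x⌋) := by
  have h1 := Int.floor_le x
  have h2 := Int.lt_floor_add_one x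
  by_cases hx : x = ⌊x⌋
  · filter_upwards [Ioo_mem_nhds (show x - 1 < x by linarith) h2] with x' ⟨h3, h4⟩
    by_cases h : (⌊x⌋ : ℝ) ≤ x'
    · left; rw [Int.floor_eq_iff]; exact ⟨h, h4⟩
    · right
      refine ⟨?_, hx⟩
      rw [Int.floor_eq_iff]
      push_cast
      constructor <;> linarith
  · filter_upwards [Ioo_mem_nhds (lt_of_le_of_ne h1 (Ne.symm hx)) h2] with x' ⟨h3, h4⟩
    left; rw [Int.floor_eq_iff]; exact ⟨h3.le, h4⟩

theorem not_covered_floor {x y : ℝ} (h : ¬ OnColumn x y) (hx : x = ⌊x⌋) : ¬ Covered ⌊x⌋ ⌊y⌋ := by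
  rintro ⟨k, h1, h2, h3⟩
  have h4 := Int.floor_le y
  have h5 := Int.lt_floor_add_one y
  have h6 : (⌊y⌋ : ℝ) + 1 ≤ gridHi k := by exact_mod_cast h3
  have h7 : (gridLo k : ℝ) ≤ ⌊y⌋ := by exact_mod_cast h2
  exact h ⟨k, by rw [hx, h1]; simp, by linarith, by linarith⟩

theorem not_covered_floor_sub_one {x y : ℝ} (h : ¬ OnColumn x y) (hx : x = ⌊x⌋) (hy : y = ⌊y⌋) :
    ¬ Covered ⌊x⌋ (⌊y⌋ - 1) := by
  rintro ⟨k, h1, h2, h3⟩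
  have h6 : (⌊y⌋ : ℝ) ≤ gridHi k := by exact_mod_cast (by omega : ⌊y⌋ ≤ gridHi k)
  have h7 : (gridLo k : ℝ) ≤ ⌊y⌋ := by exact_mod_cast (by omega : (gridLo k : ℤ) ≤ ⌊y⌋)
  exact h ⟨k, by rw [hx, h1]; simp, by linarith, by linarith⟩

/-- Off the diagram, the cell label is locally constant. -/
theorem eventually_cellLabel {G : Type*} [Group G] (a b : G) {x y : ℝ} (h1 : ¬ OnColumn x y)
    (h2 : ¬ OnColumn y x) :
    ∀ᶠ q : ℝ × ℝ in 𝓝 (x, y), cellLabel a b ⌊q.1⌋ ⌊q.2⌋ = cellLabel a b ⌊x⌋ ⌊y⌋ := by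
  filter_upwards [(continuous_fst.continuousAt (x := (x, y))).eventually (eventually_floor x),
    (continuous_snd.continuousAt (x := (x, y))).eventually (eventually_floor y)] with q hx hy
  rcases hx with hx | ⟨hx, ex⟩ <;> rcases hy with hy | ⟨hy, ey⟩ <;> rw [hx, hy]
  · exact cellLabel_sub_one_right a b (not_covered_floor h2 ey)
  · exact cellLabel_sub_one_left a b (not_covered_floor h1 ex)
  -- A lattice point off the diagram: the diagonally opposite cell is reached through two free
  -- edges.
  · rw [cellLabel_sub_one_left a b (not_covered_floor_sub_one h1 ex ey),
      cellLabel_sub_one_right a b (not_covered_floor h2 ey)]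

/-! ### The knot in coordinates -/

/-- Euclidean 3-space. -/
abbrev E3 : Type := EuclideanSpace ℝ (Fin 3)

/-- The point set of the figure-eight knot in coordinates. -/
def OnKnot (p : E3) : Prop :=
  (OnColumn (p 0) (p 1) ∧ p 2 = 1) ∨ (OnColumn (p 1) (p 0) ∧ p 2 = 0) ∨
    ∃ k : Fin 6, p 0 = (k : ℕ) ∧ (p 1 = gridLo k ∨ p 1 = gridHi k) ∧ 0 ≤ p 2 ∧ p 2 ≤ 1

theorem coe_mem_knot {p : E3} : (p : S3) ∈ figureEightKnot ↔
    ∃ i : Fin 24, p ∈ segment ℝ (figureEightVertex i) (figureEightVertex (i + 1)) := by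
  unfold figureEightKnot
  rw [OnePoint.coe_injective.mem_set_image, mem_iUnion]

theorem mem_knot_of_edge {p : E3} (i : Fin 24) (t : ℝ) (h0 : 0 ≤ t) (h1 : t ≤ 1)
    (h : ∀ k, p k = (1 - t) * figureEightVertex i k + t * figureEightVertex (i + 1) k) :
    (p : S3) ∈ figureEightKnot := by
  rw [coe_mem_knot]
  refine ⟨i, ?_⟩
  rw [segment_eq_image]
  refine ⟨t, ⟨h0, h1⟩, ?_⟩
  ext k
  simp [h k]

/-- Columns, rows and the risers at their two ends give 24 cases; each names its polygon edge and
the affine parameter along it. -/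
theorem mem_knot_of_onKnot {p : E3} (h : OnKnot p) : (p : S3) ∈ figureEightKnot := by
  rcases h with ⟨⟨k, h0, h1, h2⟩, h3⟩ | ⟨⟨k, h0, h1, h2⟩, h3⟩ | ⟨k, h0, h1 | h1, h2, h3⟩
  · fin_cases k <;> norm_num [gridLo, gridHi] at h0 h1 h2
    · exact mem_knot_of_edge 0 ((4 - p 1) / 4) (by linarith) (by linarith)
        (by intro k; fin_cases k <;> simp [figureEightVertex, h0, h3] <;> ring)
    · exact mem_knot_of_edge 16 ((5 - p 1) / 3) (by linarith) (by linarith)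
        (by intro k; fin_cases k <;> simp [figureEightVertex, h0, h3] <;> ring)
    · exact mem_knot_of_edge 8 ((3 - p 1) / 2) (by linarith) (by linarith)
        (by intro k; fin_cases k <;> simp [figureEightVertex, h0, h3] <;> ring)
    · exact mem_knot_of_edge 20 ((p 1 - 2) / 2) (by linarith) (by linarith)
        (by intro k; fin_cases k <;> simp [figureEightVertex, h0, h3] <;> ring)
    · exact mem_knot_of_edge 4 ((p 1 - 0) / 3) (by linarith) (by linarith)
        (by intro k; fin_cases k <;> simp [figureEightVertex, h0, h3] <;> ring)
    · exact mem_knot_of_edge 12 ((p 1 - 1) / 4) (by linarith) (by linarith)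
        (by intro k; fin_cases k <;> simp [figureEightVertex, h0, h3] <;> ring)
  · fin_cases k <;> norm_num [gridLo, gridHi] at h0 h1 h2
    · exact mem_knot_of_edge 2 ((p 0 - 0) / 4) (by linarith) (by linarith)
        (by intro k; fin_cases k <;> simp [figureEightVertex, h0, h3] <;> ring)
    · exact mem_knot_of_edge 10 ((p 0 - 2) / 3) (by linarith) (by linarith)
        (by intro k; fin_cases k <;> simp [figureEightVertex, h0, h3] <;> ring)
    · exact mem_knot_of_edge 18 ((p 0 - 1) / 2) (by linarith) (by linarith)
        (by intro k; fin_cases k <;> simp [figureEightVertex, h0, h3] <;> ring)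
    · exact mem_knot_of_edge 6 ((4 - p 0) / 2) (by linarith) (by linarith)
        (by intro k; fin_cases k <;> simp [figureEightVertex, h0, h3] <;> ring)
    · exact mem_knot_of_edge 22 ((3 - p 0) / 3) (by linarith) (by linarith)
        (by intro k; fin_cases k <;> simp [figureEightVertex, h0, h3] <;> ring)
    · exact mem_knot_of_edge 14 ((5 - p 0) / 4) (by linarith) (by linarith)
        (by intro k; fin_cases k <;> simp [figureEightVertex, h0, h3] <;> ring)
  · fin_cases k <;> norm_num [gridLo, gridHi] at h0 h1 h2
    · exact mem_knot_of_edge 1 ((1 - p 2) / 1) (by linarith) (by linarith)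
        (by intro k; fin_cases k <;> simp [figureEightVertex, h0, h1] <;> ring)
    · exact mem_knot_of_edge 17 ((1 - p 2) / 1) (by linarith) (by linarith)
        (by intro k; fin_cases k <;> simp [figureEightVertex, h0, h1] <;> ring)
    · exact mem_knot_of_edge 9 ((1 - p 2) / 1) (by linarith) (by linarith)
        (by intro k; fin_cases k <;> simp [figureEightVertex, h0, h1] <;> ring)
    · exact mem_knot_of_edge 19 ((p 2 - 0) / 1) (by linarith) (by linarith)
        (by intro k; fin_cases k <;> simp [figureEightVertex, h0, h1] <;> ring)
    · exact mem_knot_of_edge 3 ((p 2 - 0) / 1) (by linarith) (by linarith)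
        (by intro k; fin_cases k <;> simp [figureEightVertex, h0, h1] <;> ring)
    · exact mem_knot_of_edge 11 ((p 2 - 0) / 1) (by linarith) (by linarith)
        (by intro k; fin_cases k <;> simp [figureEightVertex, h0, h1] <;> ring)
  · fin_cases k <;> norm_num [gridLo, gridHi] at h0 h1 h2
    · exact mem_knot_of_edge 23 ((p 2 - 0) / 1) (by linarith) (by linarith)
        (by intro k; fin_cases k <;> simp [figureEightVertex, h0, h1] <;> ring)
    · exact mem_knot_of_edge 15 ((p 2 - 0) / 1) (by linarith) (by linarith)
        (by intro k; fin_cases k <;> simp [figureEightVertex, h0, h1] <;> ring)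
    · exact mem_knot_of_edge 7 ((p 2 - 0) / 1) (by linarith) (by linarith)
        (by intro k; fin_cases k <;> simp [figureEightVertex, h0, h1] <;> ring)
    · exact mem_knot_of_edge 21 ((1 - p 2) / 1) (by linarith) (by linarith)
        (by intro k; fin_cases k <;> simp [figureEightVertex, h0, h1] <;> ring)
    · exact mem_knot_of_edge 5 ((1 - p 2) / 1) (by linarith) (by linarith)
        (by intro k; fin_cases k <;> simp [figureEightVertex, h0, h1] <;> ring)
    · exact mem_knot_of_edge 13 ((1 - p 2) / 1) (by linarith) (by linarith)
        (by intro k; fin_cases k <;> simp [figureEightVertex, h0, h1] <;> ring)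

theorem exists_edge_of_mem_knot {p : E3} (h : (p : S3) ∈ figureEightKnot) :
    ∃ (i : Fin 24) (t : ℝ), 0 ≤ t ∧ t ≤ 1 ∧
      ∀ k, p k = (1 - t) * figureEightVertex i k + t * figureEightVertex (i + 1) k := by
  rw [coe_mem_knot] at h
  obtain ⟨i, hi⟩ := h
  rw [segment_eq_image] at hi
  obtain ⟨t, ⟨h0, h1⟩, rfl⟩ := hi
  exact ⟨i, t, h0, h1, fun k => by simp⟩

/-- Near the middle of the first unit of column `0`, the knot is a straight line. -/
theorem mem_knot_near {p : E3} (h0 : |p 0| < 1 / 4) (h1 : |p 1 - 1 / 2| < 1 / 4)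
    (h2 : |p 2 - 1| < 1 / 4) : (p : S3) ∈ figureEightKnot ↔ p 0 = 0 ∧ p 2 = 1 := by
  rw [abs_lt] at h0 h1 h2
  constructor
  · intro h
    obtain ⟨i, t, ht0, ht1, hk⟩ := exists_edge_of_mem_knot h
    have e0 := hk 0
    have e1 := hk 1
    have e2 := hk 2
    clear hk h
    fin_cases i <;> simp [figureEightVertex] at e0 e1 e2 <;>
      first
      | exact ⟨e0, e2⟩
      | (exfalso; linarith)
  · rintro ⟨e0, e2⟩
    refine mem_knot_of_onKnot (Or.inl ⟨⟨0, by simp [e0], ?_, ?_⟩, e2⟩) <;>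
      norm_num [gridLo, gridHi] <;> linarith

/-! ### The local systems on the complement of the figure-eight knot -/

/-- The complement of the figure-eight knot. -/
abbrev KnotCompl : Type := {x : S3 // x ∉ figureEightKnot}

/-- The box that contains the knot. -/
def knotBox : Set E3 := {p | (0 ≤ p 0 ∧ p 0 ≤ 5) ∧ (0 ≤ p 1 ∧ p 1 ≤ 5) ∧ 0 ≤ p 2 ∧ p 2 ≤ 1}

/-- The vertical walls below the columns of the knot, and the bottom of the box. -/
def upperWall : Set E3 := {p | (OnColumn (p 0) (p 1) ∨ p 2 = 0) ∧ p ∈ knotBox}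

/-- The vertical walls above the rows of the knot, and the top of the box. -/
def lowerWall : Set E3 := {p | (OnColumn (p 1) (p 0) ∨ p 2 = 1) ∧ p ∈ knotBox}

/-- Small boxes around the crossings. -/
def crossingBoxes : Set E3 :=
  {p | 0 < p 2 ∧ p 2 < 1 ∧ ∃ c r : ℤ, IsCrossing c r ∧ |p 0 - c| < 1 / 2 ∧ |p 1 - r| < 1 / 2}

theorem isClosed_knotBox : IsClosed knotBox := by
  have h (i : Fin 3) : Continuous fun p : E3 => p i := by fun_prop
  exact ((isClosed_le continuous_const (h 0)).inter (isClosed_le (h 0) continuous_const)).inter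
    (((isClosed_le continuous_const (h 1)).inter (isClosed_le (h 1) continuous_const)).inter
    ((isClosed_le continuous_const (h 2)).inter (isClosed_le (h 2) continuous_const)))

theorem isCompact_knotBox : IsCompact knotBox := by
  have := (isCompact_Icc (a := (fun _ => 0 : Fin 3 → ℝ)) (b := fun _ => 5)).image
    (PiLp.continuous_toLp 2 (fun _ : Fin 3 => ℝ))
  refine this.of_isClosed_subset isClosed_knotBox ?_
  rintro p ⟨⟨h1, h2⟩, ⟨h3, h4⟩, h5, h6⟩
  refine ⟨p.ofLp, ⟨fun i => ?_, fun i => ?_⟩, rfl⟩ <;> fin_cases i <;> simp <;> linarith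

theorem isClosed_onColumn : IsClosed {q : ℝ × ℝ | OnColumn q.1 q.2} := by
  have : {q : ℝ × ℝ | OnColumn q.1 q.2} =
      ⋃ k : Fin 6, {q : ℝ × ℝ | q.1 = (k : ℕ) ∧ (gridLo k : ℝ) ≤ q.2 ∧ q.2 ≤ gridHi k} := by
    ext q; simp [OnColumn]
  rw [this]
  refine isClosed_iUnion_of_finite fun k => ?_
  exact (isClosed_eq continuous_fst continuous_const).inter
    ((isClosed_le continuous_const continuous_snd).inter
      (isClosed_le continuous_snd continuous_const))

theorem isCompact_upperWall : IsCompact upperWall := by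
  refine isCompact_knotBox.of_isClosed_subset (IsClosed.inter (IsClosed.union ?_ ?_)
    isClosed_knotBox) fun p hp => hp.2
  · exact isClosed_onColumn.preimage (f := fun p : E3 => (p 0, p 1)) (by fun_prop)
  · exact isClosed_eq (f := fun p : E3 => p 2) (by fun_prop) continuous_const

theorem isCompact_lowerWall : IsCompact lowerWall := by
  refine isCompact_knotBox.of_isClosed_subset (IsClosed.inter (IsClosed.union ?_ ?_)
    isClosed_knotBox) fun p hp => hp.2
  · exact isClosed_onColumn.preimage (f := fun p : E3 => (p 1, p 0)) (by fun_prop)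
  · exact isClosed_eq (f := fun p : E3 => p 2) (by fun_prop) continuous_const

theorem isOpen_compl_coe_image {s : Set E3} (hs : IsCompact s) :
    IsOpen (((↑) : E3 → S3) '' s)ᶜ :=
  OnePoint.isOpen_compl_image_coe.2 ⟨hs.isClosed, hs⟩

theorem isOpen_crossingBoxes : IsOpen crossingBoxes := by
  have h (i : Fin 3) : Continuous fun p : E3 => p i := by fun_prop
  have h2 : crossingBoxes = {p : E3 | 0 < p 2} ∩ ({p : E3 | p 2 < 1} ∩ ⋃ (c : ℤ) (r : ℤ),
      {p : E3 | IsCrossing c r ∧ |p 0 - c| < 1 / 2 ∧ |p 1 - r| < 1 / 2}) := by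
    ext p; simp [crossingBoxes]
  rw [h2]
  refine (isOpen_lt continuous_const (h 2)).inter ((isOpen_lt (h 2) continuous_const).inter
    (isOpen_iUnion fun c => isOpen_iUnion fun r => ?_))
  exact isOpen_const.inter ((isOpen_lt ((h 0).sub continuous_const).abs continuous_const).inter
    (isOpen_lt ((h 1).sub continuous_const).abs continuous_const))

/-- A column and a row meet either at a common corner, where a riser of the knot fills the whole
height of the box, or at a crossing. This is what makes the crossing boxes sufficient as a third
chart. -/
theorem grid_intersections : ∀ c r : Fin 6, gridLo c ≤ r → (r : ℕ) ≤ gridHi c → gridLo r ≤ c →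
    (c : ℕ) ≤ gridHi r → ((r : ℕ) = gridLo c ∨ (r : ℕ) = gridHi c) ∨ IsCrossing (c : ℕ) (r : ℕ) := by
  decide

/-- On the top or bottom face, a point in both walls would lie on a strand of the knot; strictly
between the faces, `grid_intersections` applies. -/
theorem mem_crossingBoxes {p : E3} (h1 : p ∈ upperWall) (h2 : p ∈ lowerWall)
    (hK : (p : S3) ∉ figureEightKnot) : p ∈ crossingBoxes := by
  obtain ⟨h1, -, -, h3, h4⟩ := h1
  obtain ⟨h2, -⟩ := h2
  have hK' : ¬ OnKnot p := fun h => hK (mem_knot_of_onKnot h)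
  have hz1 : OnColumn (p 0) (p 1) → p 2 ≠ 1 := fun h h' => hK' (Or.inl ⟨h, h'⟩)
  have hz0 : OnColumn (p 1) (p 0) → p 2 ≠ 0 := fun h h' => hK' (Or.inr (Or.inl ⟨h, h'⟩))
  rcases h1 with hc | h1
  · rcases h2 with hr | h2
    · refine ⟨lt_of_le_of_ne h3 (hz0 hr).symm, lt_of_le_of_ne h4 (hz1 hc), ?_⟩
      obtain ⟨c, hc0, hc1, hc2⟩ := hc
      obtain ⟨r, hr0, hr1, hr2⟩ := hr
      rw [hr0] at hc1 hc2
      rw [hc0] at hr1 hr2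
      have := grid_intersections c r (by exact_mod_cast hc1) (by exact_mod_cast hc2)
        (by exact_mod_cast hr1) (by exact_mod_cast hr2)
      rcases this with h | h
      · refine absurd (Or.inr (Or.inr ⟨c, hc0, ?_, h3, h4⟩)) hK'
        rw [hr0]
        exact h.imp (congrArg _) (congrArg _)
      · exact ⟨_, _, h, by rw [hc0]; simp, by rw [hr0]; simp⟩
    · exact absurd h2 (hz1 hc)
  · rcases h2 with hr | h2
    · exact absurd h1 (hz0 hr)
    · rw [h1] at h2; norm_num at h2

/-- The charts of the local systems. -/
inductive Chart
  | top
  | low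
  | cross

namespace Chart

/-- The domains of the charts. -/
def dom : Chart → Set S3
  | top => ((↑) '' upperWall)ᶜ
  | low => ((↑) '' lowerWall)ᶜ
  | cross => (↑) '' crossingBoxes

theorem isOpen_dom : ∀ i : Chart, IsOpen i.dom
  | top => isOpen_compl_coe_image isCompact_upperWall
  | low => isOpen_compl_coe_image isCompact_lowerWall
  | cross => OnePoint.isOpen_image_coe.2 isOpen_crossingBoxes

theorem exists_mem_dom {x : S3} (hx : x ∉ figureEightKnot) : ∃ i : Chart, x ∈ i.dom := by
  by_contra! h
  obtain ⟨p, hp, rfl⟩ := not_not.1 (h top)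
  obtain ⟨q, hq, hqp⟩ := not_not.1 (h low)
  obtain rfl := OnePoint.coe_injective hqp
  exact h cross ⟨q, mem_crossingBoxes hp hq hx, rfl⟩

variable {G : Type*} [Group G] (a b : G)

/-- The flat sections over the charts. -/
def sec : Chart → S3 → G
  | top, x => x.elim 1 fun p => if 0 < p 2 ∧ p 2 < 1 then cellLabel a b ⌊p 0⌋ ⌊p 1⌋ else 1
  -- Normalization: with section 1 here, the cell labels are exactly the transition functions
  -- between the top and low charts.
  | low, _ => 1
  -- Within a crossing box rounding recovers the column `c`, so this is the label of the cell to the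
  -- left of the column, whichever side the point is on.
  | cross, x => x.elim 1 fun p => cellLabel a b (⌊p 0 + 1 / 2⌋ - 1) ⌊p 1⌋

theorem sec_top_of_notMem {x : S3} (hx : x ∉ ((↑) : E3 → S3) '' knotBox) :
    sec a b top x = 1 := by
  induction x using OnePoint.rec with
  | infty => rfl
  | coe p =>
    change (if 0 < p 2 ∧ p 2 < 1 then cellLabel a b ⌊p 0⌋ ⌊p 1⌋ else 1) = 1
    split_ifs with h
    · apply cellLabel_eq_one
      by_contra! hc
      refine hx ⟨p, ⟨⟨?_, ?_⟩, ⟨?_, ?_⟩, h.1.le, h.2.le⟩, rfl⟩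
      · exact Int.floor_nonneg.1 hc.1
      · have := Int.lt_floor_add_one (p 0)
        have h2 : (⌊p 0⌋ : ℝ) ≤ 4 := by exact_mod_cast hc.2.1
        linarith
      · exact Int.floor_nonneg.1 hc.2.2.1
      · have := Int.lt_floor_add_one (p 1)
        have h2 : (⌊p 1⌋ : ℝ) ≤ 4 := by exact_mod_cast hc.2.2.2
        linarith
    · rfl

theorem sec_top_coe {p : E3} (h : 0 < p 2 ∧ p 2 < 1) :
    sec a b top p = cellLabel a b ⌊p 0⌋ ⌊p 1⌋ := if_pos h

theorem sec_cross_coe (p : E3) :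
    sec a b cross p = cellLabel a b (⌊p 0 + 1 / 2⌋ - 1) ⌊p 1⌋ := rfl

theorem eventually_coe {p : E3} {P : S3 → Prop} (h : ∀ᶠ q : E3 in 𝓝 p, P q) :
    ∀ᶠ y in 𝓝 (p : S3), P y := by
  rw [OnePoint.nhds_coe_eq]
  exact h

theorem eventually_slab {p : E3} (h : 0 < p 2 ∧ p 2 < 1) : ∀ᶠ q : E3 in 𝓝 p, 0 < q 2 ∧ q 2 < 1 :=
  (continuous_apply 2 |>.comp (PiLp.continuous_ofLp 2 _)).continuousAt.eventually
    (Ioo_mem_nhds h.1 h.2)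

/-- In the box, an overlap point lies off all strands in projection and strictly between the faces,
where the cell label cannot jump; outside the box the section is 1. -/
theorem eventually_sec_top {x : S3} (h1 : x ∈ top.dom) (h2 : x ∈ low.dom) :
    ∀ᶠ y in 𝓝 x, sec a b top y = sec a b top x := by
  by_cases hx : x ∈ ((↑) : E3 → S3) '' knotBox
  · obtain ⟨p, hp, rfl⟩ := hx
    have h1 : ¬ (OnColumn (p 0) (p 1) ∨ p 2 = 0) := fun h => h1 ⟨p, ⟨h, hp⟩, rfl⟩
    have h2 : ¬ (OnColumn (p 1) (p 0) ∨ p 2 = 1) := fun h => h2 ⟨p, ⟨h, hp⟩, rfl⟩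
    push Not at h1 h2
    have hz : 0 < p 2 ∧ p 2 < 1 :=
      ⟨lt_of_le_of_ne hp.2.2.1 h1.2.symm, lt_of_le_of_ne hp.2.2.2 h2.2⟩
    apply eventually_coe
    have hc : Continuous fun q : E3 => (q 0, q 1) := by fun_prop
    filter_upwards [eventually_slab hz,
      hc.continuousAt.eventually (eventually_cellLabel a b h1.1 h2.1)] with q hq1 hq2
    rw [sec_top_coe a b hq1, sec_top_coe a b hz]
    exact hq2
  · rw [sec_top_of_notMem a b hx]
    filter_upwards [(isOpen_compl_coe_image isCompact_knotBox).mem_nhds hx] with y hy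
    exact sec_top_of_notMem a b hy

/-- Both strands continue at least one unit beyond a crossing, so within distance 1/2 of it the
walls have no free edge. -/
theorem crossing_bounds {c r : ℤ} (h : IsCrossing c r) : ∃ k l : Fin 6, c = (k : ℕ) ∧ r = (l : ℕ) ∧
    (gridLo k : ℤ) < r ∧ r < gridHi k ∧ (gridLo l : ℤ) < c ∧ c < gridHi l := by
  rcases h with ⟨rfl, rfl⟩ | ⟨rfl, rfl⟩ | ⟨rfl, rfl⟩ | ⟨rfl, rfl⟩
  · exact ⟨1, 4, by decide⟩
  · exact ⟨3, 3, by decide⟩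
  · exact ⟨2, 2, by decide⟩
  · exact ⟨4, 1, by decide⟩

theorem mem_knotBox_of_crossing {p : E3} {c r : ℤ} (h : IsCrossing c r) (hz : 0 < p 2 ∧ p 2 < 1)
    (h0 : |p 0 - c| < 1 / 2) (h1 : |p 1 - r| < 1 / 2) : p ∈ knotBox := by
  rw [abs_lt] at h0 h1
  refine ⟨?_, ?_, hz.1.le, hz.2.le⟩ <;>
    rcases h with ⟨rfl, rfl⟩ | ⟨rfl, rfl⟩ | ⟨rfl, rfl⟩ | ⟨rfl, rfl⟩ <;> push_cast at * <;>
    constructor <;> linarith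

theorem ne_of_crossing_of_mem_top {p : E3} {c r : ℤ} (h : IsCrossing c r)
    (hz : 0 < p 2 ∧ p 2 < 1) (h0 : |p 0 - c| < 1 / 2) (h1 : |p 1 - r| < 1 / 2)
    (ht : (p : S3) ∈ top.dom) : p 0 ≠ c := by
  intro hc
  refine ht ⟨p, ⟨Or.inl ?_, mem_knotBox_of_crossing h hz h0 h1⟩, rfl⟩
  obtain ⟨k, l, hk, hl, h2, h3, -, -⟩ := crossing_bounds h
  have h2' : (gridLo k : ℝ) + 1 ≤ r := by exact_mod_cast h2
  have h3' : (r : ℝ) + 1 ≤ gridHi k := by exact_mod_cast h3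
  rw [abs_lt] at h1
  exact ⟨k, by rw [hc, hk]; simp, by linarith, by linarith⟩

theorem ne_of_crossing_of_mem_low {p : E3} {c r : ℤ} (h : IsCrossing c r)
    (hz : 0 < p 2 ∧ p 2 < 1) (h0 : |p 0 - c| < 1 / 2) (h1 : |p 1 - r| < 1 / 2)
    (ht : (p : S3) ∈ low.dom) : p 1 ≠ r := by
  intro hc
  refine ht ⟨p, ⟨Or.inl ?_, mem_knotBox_of_crossing h hz h0 h1⟩, rfl⟩
  obtain ⟨k, l, hk, hl, -, -, h2, h3⟩ := crossing_bounds h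
  have h2' : (gridLo l : ℝ) + 1 ≤ c := by exact_mod_cast h2
  have h3' : (c : ℝ) + 1 ≤ gridHi l := by exact_mod_cast h3
  rw [abs_lt] at h0
  exact ⟨l, by rw [hc, hl]; simp, by linarith, by linarith⟩

theorem eventually_floor_of_ne {x : ℝ} {c : ℤ} (h : |x - c| < 1 / 2) (hc : x ≠ c) :
    ∀ᶠ y in 𝓝 x, ⌊y⌋ = ⌊x⌋ := by
  filter_upwards [eventually_floor x] with y hy
  rcases hy with hy | ⟨-, hy⟩
  · exact hy
  · exfalso
    rw [hy] at h hc
    have h2 : |⌊x⌋ - c| < 1 := by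
      have : |((⌊x⌋ - c : ℤ) : ℝ)| < 1 := by push_cast; linarith
      exact_mod_cast this
    rw [Int.abs_lt_one_iff, sub_eq_zero] at h2
    exact hc (by rw [h2])

theorem floor_add_half {x : ℝ} {c : ℤ} (h : |x - c| < 1 / 2) : ⌊x + 1 / 2⌋ = c := by
  rw [abs_lt] at h
  rw [Int.floor_eq_iff]
  constructor <;> linarith

theorem eventually_near {p : E3} {c : ℤ} (i : Fin 3) (h : |p i - c| < 1 / 2) :
    ∀ᶠ q : E3 in 𝓝 p, |q i - c| < 1 / 2 := by
  have : Continuous fun q : E3 => |q i - c| := by fun_prop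
  exact this.continuousAt.eventually_lt continuousAt_const h

/-- Off the wall of the understrand the row of cells is locally fixed, and inside a crossing box the
section depends on nothing else. -/
theorem eventually_sec_cross {x : S3} (h1 : x ∈ low.dom) (h2 : x ∈ cross.dom) :
    ∀ᶠ y in 𝓝 x, sec a b cross y = sec a b cross x := by
  obtain ⟨p, ⟨hz, hz', c, r, h, hc, hr⟩, rfl⟩ := h2
  have hne := ne_of_crossing_of_mem_low h ⟨hz, hz'⟩ hc hr h1
  apply eventually_coe
  have hq : Continuous fun q : E3 => q 1 := by fun_prop
  filter_upwards [eventually_near 0 hc,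
    hq.continuousAt.eventually (eventually_floor_of_ne hr hne)] with q h3 h4
  rw [sec_cross_coe, sec_cross_coe, floor_add_half hc, floor_add_half h3, h4]

theorem floor_cases {x : ℝ} {r : ℤ} (h : |x - r| < 1 / 2) : ⌊x⌋ = r - 1 ∨ ⌊x⌋ = r := by
  rw [abs_lt] at h
  by_cases hx : x < r
  · left; rw [Int.floor_eq_iff]; push_cast; constructor <;> linarith
  · right; rw [Int.floor_eq_iff]; constructor <;> linarith

-- The quotient is 1 to the left of the column and the holonomy around the overstrand to the right;
-- by `cellLabel_crossing` it does not change when the row is crossed.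
variable {a b} in
theorem eventually_sec_top_cross (hR : b⁻¹ * a⁻¹ * b * a⁻¹ * b⁻¹ * a * b * a⁻¹ * b * a = 1)
    {x : S3} (h1 : x ∈ top.dom) (h2 : x ∈ cross.dom) :
    ∀ᶠ y in 𝓝 x, sec a b top y * (sec a b cross y)⁻¹ =
      sec a b top x * (sec a b cross x)⁻¹ := by
  obtain ⟨p, ⟨hz, hz', c, r, h, hc, hr⟩, rfl⟩ := h2
  have hne := ne_of_crossing_of_mem_top h ⟨hz, hz'⟩ hc hr h1
  apply eventually_coe
  have hq : Continuous fun q : E3 => q 0 := by fun_prop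
  filter_upwards [eventually_near 0 hc, eventually_near 1 hr, eventually_slab ⟨hz, hz'⟩,
    hq.continuousAt.eventually (eventually_floor_of_ne hc hne)] with q h3 h4 h5 h6
  rw [sec_cross_coe, sec_cross_coe, floor_add_half hc, floor_add_half h3,
    sec_top_coe a b ⟨hz, hz'⟩, sec_top_coe a b h5, h6]
  have hX := cellLabel_crossing hR h
  rcases floor_cases hc with e0 | e0 <;> rcases floor_cases hr with e1 | e1 <;>
    rcases floor_cases h4 with e2 | e2 <;> rw [e0, e1, e2] <;> simp [hX]

end Chart

/-- The local system on the knot complement with holonomies `a` and `b` around the columns `0`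
and `1` of the grid diagram. -/
def knotSystem {G : Type*} [Group G] (a b : G)
    (hR : b⁻¹ * a⁻¹ * b * a⁻¹ * b⁻¹ * a * b * a⁻¹ * b * a = 1) : LocalSystem KnotCompl G Chart where
  U i := Subtype.val ⁻¹' i.dom
  isOpen_U i := i.isOpen_dom.preimage continuous_subtype_val
  idx x := (Chart.exists_mem_dom x.2).choose
  mem_idx x := (Chart.exists_mem_dom x.2).choose_spec
  sec i x := i.sec a b x
  locConst i j x hi hj := by
    apply (continuous_subtype_val.continuousAt (x := x)).eventually
      (p := fun y => Chart.sec a b j y * (Chart.sec a b i y)⁻¹ = _)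
    have symm {u v w z : G} (h : u * v⁻¹ = w * z⁻¹) : v * u⁻¹ = z * w⁻¹ := by
      rw [← inv_inj, mul_inv_rev, mul_inv_rev, inv_inv, inv_inv, h]
    cases i <;> cases j
    · simp
    · filter_upwards [Chart.eventually_sec_top a b hi hj] with y hy
      simp [Chart.sec] at hy ⊢; exact hy
    · exact (Chart.eventually_sec_top_cross hR hi hj).mono fun y => symm
    · filter_upwards [Chart.eventually_sec_top a b hj hi] with y hy
      rw [hy]; rfl
    · simp
    · filter_upwards [Chart.eventually_sec_cross a b hi hj] with y hy
      rw [hy]; rfl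
    · exact Chart.eventually_sec_top_cross hR hj hi
    · filter_upwards [Chart.eventually_sec_cross a b hj hi] with y hy
      rw [hy]; rfl
    · simp

/-! ### Loops around the columns of the diagram -/

/-- Every edge of the polygon keeps one of its first two coordinates at an integer; hence the open
vertical column over a cell misses the knot. -/
theorem mem_knot_bounds {p : E3} (h : (p : S3) ∈ figureEightKnot) :
    p ∈ knotBox ∧ ((∃ n : ℤ, p 0 = n) ∨ ∃ n : ℤ, p 1 = n) := by
  obtain ⟨i, t, ht0, ht1, hk⟩ := exists_edge_of_mem_knot h
  have e0 := hk 0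
  have e1 := hk 1
  have e2 := hk 2
  clear hk h
  fin_cases i <;> simp [figureEightVertex] at e0 e1 e2 <;>
    refine ⟨⟨⟨?_, ?_⟩, ⟨?_, ?_⟩, ?_, ?_⟩, ?_⟩ <;> first
      | linarith
      | exact Or.inl ⟨0, by push_cast; linarith⟩
      | exact Or.inl ⟨1, by push_cast; linarith⟩
      | exact Or.inl ⟨2, by push_cast; linarith⟩
      | exact Or.inl ⟨3, by push_cast; linarith⟩
      | exact Or.inl ⟨4, by push_cast; linarith⟩
      | exact Or.inl ⟨5, by push_cast; linarith⟩
      | exact Or.inr ⟨0, by push_cast; linarith⟩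
      | exact Or.inr ⟨1, by push_cast; linarith⟩
      | exact Or.inr ⟨2, by push_cast; linarith⟩
      | exact Or.inr ⟨3, by push_cast; linarith⟩
      | exact Or.inr ⟨4, by push_cast; linarith⟩
      | exact Or.inr ⟨5, by push_cast; linarith⟩

theorem joinedIn_of_convex {C : Set E3} (hC : Convex ℝ C)
    (hK : ∀ p ∈ C, (p : S3) ∉ figureEightKnot) {s : Set S3} (hs : ∀ p ∈ C, (p : S3) ∈ s) {x y : E3}
    (hx : x ∈ C) (hy : y ∈ C) :
    JoinedIn (Subtype.val ⁻¹' s) (⟨x, hK x hx⟩ : KnotCompl) ⟨y, hK y hy⟩ := by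
  let f : C → KnotCompl := fun p => ⟨(p : E3), hK p p.2⟩
  have hf : Continuous f := (OnePoint.continuous_coe.comp continuous_subtype_val).subtype_mk _
  have hp : IsPathConnected C := hC.isPathConnected ⟨x, hx⟩
  have := isPathConnected_iff_pathConnectedSpace.1 hp
  obtain ⟨γ⟩ := PathConnectedSpace.joined (⟨x, hx⟩ : C) ⟨y, hy⟩
  exact ⟨γ.map hf, fun t => hs _ (γ t).2⟩

theorem convex_coord {s : Set ℝ} (hs : Convex ℝ s) (i : Fin 3) : Convex ℝ {p : E3 | p i ∈ s} :=
  hs.linear_preimage (EuclideanSpace.proj i : E3 →L[ℝ] ℝ).toLinearMap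

theorem notMem_of_notMem_knotBox {p : E3} (h : p ∉ knotBox) : (p : S3) ∉ figureEightKnot :=
  fun hK => h (mem_knot_bounds hK).1

theorem mem_dom_of_notMem_knotBox {p : E3} (h : p ∉ knotBox) :
    (p : S3) ∈ Chart.top.dom ∧ (p : S3) ∈ Chart.low.dom := by
  constructor <;> rintro ⟨q, hq, hqp⟩ <;> obtain rfl := OnePoint.coe_injective hqp <;> exact h hq.2

theorem int_notMem_Ioo {x : ℝ} {i n : ℤ} (h : x ∈ Ioo (i : ℝ) (i + 1)) : x ≠ n := by
  rintro rfl
  obtain ⟨h1, h2⟩ := h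
  have h1' : i < n := by exact_mod_cast h1
  have h2' : n < i + 1 := by exact_mod_cast h2
  omega

theorem not_onColumn_of_mem_Ioo {x y : ℝ} {i : ℤ} (h : x ∈ Ioo (i : ℝ) (i + 1)) :
    ¬ OnColumn x y := by
  rintro ⟨k, hk, -⟩
  exact int_notMem_Ioo (n := (k : ℕ)) h (by rw [hk]; simp)

/-- The open vertical column over a cell. -/
def cellColumn (i j : ℤ) : Set E3 :=
  {p | p 0 ∈ Ioo (i : ℝ) (i + 1)} ∩ {p | p 1 ∈ Ioo (j : ℝ) (j + 1)}

theorem convex_cellColumn (i j : ℤ) : Convex ℝ (cellColumn i j) :=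
  (convex_coord (convex_Ioo _ _) 0).inter (convex_coord (convex_Ioo _ _) 1)

theorem notMem_knot_of_mem_cellColumn {i j : ℤ} {p : E3} (h : p ∈ cellColumn i j) :
    (p : S3) ∉ figureEightKnot := by
  intro hK
  rcases (mem_knot_bounds hK).2 with ⟨n, hn⟩ | ⟨n, hn⟩
  · exact int_notMem_Ioo h.1 hn
  · exact int_notMem_Ioo h.2 hn

/-- The point above, in, or below the middle of a cell. -/
def cellPoint (i j : ℤ) (z : ℝ) : E3 := !₂[(i : ℝ) + 1 / 2, (j : ℝ) + 1 / 2, z]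

@[simp] theorem cellPoint_two (i j : ℤ) (z : ℝ) : cellPoint i j z 2 = z := rfl

theorem cellPoint_mem (i j : ℤ) (z : ℝ) : cellPoint i j z ∈ cellColumn i j := by
  constructor <;> constructor <;> simp [cellPoint] <;> norm_num

/-- The base point for the loops around the columns. -/
def farPoint (z : ℝ) : E3 := !₂[-1, -1, z]

@[simp] theorem farPoint_zero (z : ℝ) : farPoint z 0 = -1 := rfl

@[simp] theorem farPoint_two (z : ℝ) : farPoint z 2 = z := rfl

theorem farPoint_notMem (z : ℝ) : farPoint z ∉ knotBox := by
  rintro ⟨⟨h, -⟩, -⟩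
  norm_num [farPoint] at h

/-- The loop passes above the box, descends through the cell to half height within the top chart,
and returns below and to the left of the box within the low chart. Only the change of chart inside
the cell contributes. -/
theorem exists_loop {G : Type*} [Group G] (a b : G)
    (hR : b⁻¹ * a⁻¹ * b * a⁻¹ * b⁻¹ * a * b * a⁻¹ * b * a = 1) (i j : ℤ) :
    ∃ p : Path (⟨farPoint 2, notMem_of_notMem_knotBox (farPoint_notMem 2)⟩ : KnotCompl)
      ⟨farPoint 2, notMem_of_notMem_knotBox (farPoint_notMem 2)⟩,
      (knotSystem a b hR).holonomy.hol p = (cellLabel a b i j)⁻¹ := by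
  have above : ∀ p ∈ {p : E3 | p 2 ∈ Ioi (1 : ℝ)}, p ∉ knotBox := fun p hp h =>
    absurd h.2.2.2 (not_le.2 hp)
  have below : ∀ p ∈ {p : E3 | p 2 ∈ Iio (0 : ℝ)}, p ∉ knotBox := fun p hp h =>
    absurd h.2.2.1 (not_le.2 hp)
  have left : ∀ p ∈ {p : E3 | p 0 ∈ Iio (0 : ℝ)}, p ∉ knotBox := fun p hp h =>
    absurd h.1.1 (not_le.2 hp)
  have j1 := joinedIn_of_convex (convex_coord (convex_Ioi (1 : ℝ)) 2)
    (fun p hp => notMem_of_notMem_knotBox (above p hp))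
    (fun p hp => (mem_dom_of_notMem_knotBox (above p hp)).1) (x := farPoint 2)
    (y := cellPoint i j 2) (by norm_num) (by norm_num)
  have j2 := joinedIn_of_convex
    ((convex_cellColumn i j).inter (convex_coord (convex_Ioi (0 : ℝ)) 2))
    (fun p hp => notMem_knot_of_mem_cellColumn hp.1)
    (s := Chart.top.dom) (fun p hp => by
      rintro ⟨q, hq, hqp⟩
      obtain rfl := OnePoint.coe_injective hqp
      rcases hq.1 with h | h
      · exact not_onColumn_of_mem_Ioo hp.1.1 h
      · exact absurd h (ne_of_gt hp.2))
    (x := cellPoint i j 2) (y := cellPoint i j (1 / 2))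
    ⟨cellPoint_mem i j 2, by norm_num⟩
    ⟨cellPoint_mem i j _, by norm_num⟩
  have j3 := joinedIn_of_convex
    ((convex_cellColumn i j).inter (convex_coord (convex_Iio (1 : ℝ)) 2))
    (fun p hp => notMem_knot_of_mem_cellColumn hp.1)
    (s := Chart.low.dom) (fun p hp => by
      rintro ⟨q, hq, hqp⟩
      obtain rfl := OnePoint.coe_injective hqp
      rcases hq.1 with h | h
      · exact not_onColumn_of_mem_Ioo hp.1.2 h
      · exact absurd h (ne_of_lt hp.2))
    (x := cellPoint i j (1 / 2)) (y := cellPoint i j (-1))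
    ⟨cellPoint_mem i j _, by norm_num⟩
    ⟨cellPoint_mem i j _, by norm_num⟩
  have j4 := joinedIn_of_convex (convex_coord (convex_Iio (0 : ℝ)) 2)
    (fun p hp => notMem_of_notMem_knotBox (below p hp))
    (fun p hp => (mem_dom_of_notMem_knotBox (below p hp)).2) (x := cellPoint i j (-1))
    (y := farPoint (-1)) (by norm_num) (by norm_num)
  have j5 := joinedIn_of_convex (convex_coord (convex_Iio (0 : ℝ)) 0)
    (fun p hp => notMem_of_notMem_knotBox (left p hp))
    (fun p hp => (mem_dom_of_notMem_knotBox (left p hp)).2) (x := farPoint (-1))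
    (y := farPoint 2) (by norm_num) (by norm_num)
  obtain ⟨p, hp⟩ := j1.trans j2
  obtain ⟨q, hq⟩ := (j3.trans j4).trans j5
  refine ⟨p.trans q, ?_⟩
  rw [Holonomy.hol_trans, (knotSystem a b hR).hol_of_forall_mem p Chart.top hp,
    (knotSystem a b hR).hol_of_forall_mem q Chart.low hq]
  have e1 : (knotSystem a b hR).sec Chart.top
      ⟨farPoint 2, notMem_of_notMem_knotBox (farPoint_notMem 2)⟩ = 1 := by
    refine Chart.sec_top_of_notMem a b (x := (farPoint 2 : S3)) ?_
    rintro ⟨q, hq, hqp⟩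
    rw [OnePoint.coe_injective hqp] at hq
    exact farPoint_notMem _ hq
  have e2 : (knotSystem a b hR).sec Chart.top
      ⟨cellPoint i j (1 / 2), notMem_knot_of_mem_cellColumn (cellPoint_mem i j _)⟩ =
      cellLabel a b i j := by
    refine (Chart.sec_top_coe a b (p := cellPoint i j (1 / 2))
      (by norm_num)).trans ?_
    have f (n : ℤ) : ⌊(n : ℝ) + 1 / 2⌋ = n := by
      rw [Int.floor_eq_iff]; constructor <;> linarith
    simp only [cellPoint, PiLp.toLp_apply, Matrix.cons_val_zero, Matrix.cons_val_one, f]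
  rw [e1, e2]
  simp [knotSystem, Chart.sec]

/-! ### Deck translations -/

/-- The translation of `ℝ × ℂ` by `(0, 2πin)`. -/
def shift (n : ℤ) : C(ℝ × ℂ, ℝ × ℂ) where
  toFun u := (u.1, u.2 + n * (2 * Real.pi * Complex.I))
  continuous_toFun := by fun_prop

theorem shift_apply (n : ℤ) (u : ℝ × ℂ) : shift n u = (u.1, u.2 + n * (2 * Real.pi * Complex.I)) :=
  rfl

theorem shift_shift (m n : ℤ) (u : ℝ × ℂ) : shift m (shift n u) = shift (m + n) u := by
  simp only [shift_apply]; push_cast; congr 1; ring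

@[simp] theorem shift_zero (u : ℝ × ℂ) : shift 0 u = u := by simp [shift_apply]

theorem isConj_zpow {G : Type*} [Group G] {g h : G} (hgh : IsConj g h) (n : ℤ) :
    IsConj (g ^ n) (h ^ n) := by
  obtain ⟨c, rfl⟩ := isConj_iff.1 hgh
  exact isConj_iff.2 ⟨c, by rw [conj_zpow]⟩

theorem Holonomy.dev_zpow {X Y : Type*} [TopologicalSpace X] [TopologicalSpace Y]
    [SimplyConnectedSpace Y] {G : Type*} [Group G] (H : Holonomy X G) (f : C(Y, X))
    (T : ℤ → C(Y, Y)) (hT : ∀ m n u, T m (T n u) = T (m + n) u) (hT0 : ∀ u, T 0 u = u)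
    (hf : ∀ n u, f (T n u) = f u) (u : Y) (n : ℤ) :
    H.dev f u (T n u) = H.dev f u (T 1 u) ^ n := by
  have add (m n : ℤ) : H.dev f u (T (m + n) u) = H.dev f u (T m u) * H.dev f u (T n u) := by
    rw [← H.dev_mul f u (T n u), ← H.dev_comp f (T n) (hf n) u (T m u), hT, add_comm n m]
  induction n with
  | zero => rw [hT0, H.dev_self, zpow_zero]
  | succ n ih => rw [add, ih, zpow_add_one]
  | pred n ih =>
    have h := add (-(n : ℤ) - 1) 1
    rw [sub_add_cancel, ih] at h
    rw [zpow_sub_one, h, mul_inv_cancel_right]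

theorem Holonomy.dev_shift {X : Type*} [TopologicalSpace X] {G : Type*} [Group G]
    (H : Holonomy X G) (f : C(ℝ × ℂ, X)) (hf : ∀ n u, f (shift n u) = f u) (u : ℝ × ℂ) (n : ℤ) :
    H.dev f u (shift n u) = H.dev f u (shift 1 u) ^ n :=
  H.dev_zpow f shift shift_shift shift_zero hf u n

/-! ### Tubes around the knot -/

/-- A parametrized tube around an arc of the figure-eight knot. -/
structure Tube where
  toFun : C(ℝ × ℂ, S3)
  mem_iff : ∀ p, toFun p ∈ figureEightKnot ↔ p.2 = 0
  inv : S3 → ℝ × ℂ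
  nhd : Set S3
  isOpen_nhd : IsOpen nhd
  mem_nhd : toFun (0, 0) ∈ nhd
  right_inv : ∀ x ∈ nhd, toFun (inv x) = x
  continuousOn_inv : ContinuousOn inv nhd

namespace Tube

/-- The universal covering of the complement of the core of a tube. -/
def cover (T : Tube) : C(ℝ × ℂ, KnotCompl) where
  toFun u := ⟨T.toFun (u.1, Complex.exp u.2), by simp [T.mem_iff, Complex.exp_ne_zero]⟩
  continuous_toFun := by
    refine Continuous.subtype_mk (T.toFun.continuous.comp ?_) _
    fun_prop

theorem cover_shift (T : Tube) (n : ℤ) (u : ℝ × ℂ) : T.cover (shift n u) = T.cover u := by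
  apply Subtype.ext
  change T.toFun (_, Complex.exp (_ + _)) = T.toFun (_, Complex.exp _)
  rw [Complex.exp_add, Complex.exp_int_mul_two_pi_mul_I, mul_one]
  rfl

/-- The holonomy of the meridian of a tube. -/
def meridianHol (T : Tube) {G : Type*} [Group G] (H : Holonomy KnotCompl G) : G :=
  H.dev T.cover 0 (shift 1 0)

theorem isConj_meridianHol (T : Tube) {G : Type*} [Group G] (H : Holonomy KnotCompl G)
    (u : ℝ × ℂ) : IsConj (T.meridianHol H) (H.dev T.cover u (shift 1 u)) :=
  H.isConj_dev T.cover (shift 1) (T.cover_shift 1) 0 u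

/-- Every closed curve in a punctured disc has a logarithm. -/
theorem exists_log (c : C(I, ℂ)) (hc : ∀ t, c t ≠ 0) :
    ∃ Γ : C(I, ℂ), ∀ t, Complex.exp (Γ t) = c t := by
  let γ : C(I, {z : ℂ // z ≠ 0}) := ⟨fun t => ⟨c t, hc t⟩, by fun_prop⟩
  have h0 : γ 0 = ⟨_, (Complex.log (c 0)).exp_ne_zero⟩ :=
    Subtype.ext (Complex.exp_log (hc 0)).symm
  refine ⟨Complex.isCoveringMap_exp.liftPath γ _ h0, fun t => ?_⟩
  exact congrArg Subtype.val (congrFun (Complex.isCoveringMap_exp.liftPath_lifts γ _ h0) t)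

/-- If two tubes have the same centre, the meridian of one of them is conjugate to a power of the
meridian of the other one. -/
theorem exists_isConj_zpow (T₁ T₂ : Tube) (h : T₁.toFun (0, 0) = T₂.toFun (0, 0)) :
    -- The exponent is a winding number, fixed before group and holonomy are chosen; this uniformity
    -- permits testing it in ℤ.
    ∃ n : ℤ, ∀ (G : Type) [Group G] (H : Holonomy KnotCompl G),
      IsConj (T₂.meridianHol H) (T₁.meridianHol H ^ n) := by
  obtain ⟨ε, hε, hball⟩ : ∃ ε > 0, ∀ w : ℂ, ‖w‖ < ε → T₂.toFun (0, w) ∈ T₁.nhd := by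
    have hc : Continuous fun w : ℂ => T₂.toFun (0, w) := by fun_prop
    have := hc.continuousAt.preimage_mem_nhds (x := 0) (T₁.isOpen_nhd.mem_nhds (h ▸ T₁.mem_nhd))
    obtain ⟨ε, hε, hb⟩ := Metric.mem_nhds_iff.1 this
    exact ⟨ε, hε, fun w hw => hb (by simpa using hw)⟩
  -- In the exponential coordinate, this and `line` describe the circle of radius ε/2 around the
  -- core of `T₂`.
  set u : ℝ × ℂ := (0, (Real.log (ε / 2) : ℂ)) with hu
  let line : C(I, ℝ × ℂ) :=
    ⟨fun t => (0, (Real.log (ε / 2) : ℂ) + (t : ℝ) * (2 * Real.pi * Complex.I)), by fun_prop⟩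
  have hl0 : line 0 = u := by simp [line, hu]
  have hl1 : line 1 = shift 1 u := by simp [line, hu, shift_apply]
  have hmem (t : I) : (T₂.cover (line t) : S3) ∈ T₁.nhd := by
    apply hball
    rw [Complex.norm_exp]
    have : (line t).2.re = Real.log (ε / 2) := by simp [line]
    rw [this, Real.exp_log (by linarith)]
    linarith
  let γ : C(I, ℝ × ℂ) := ⟨fun t => T₁.inv (T₂.cover (line t)),
    T₁.continuousOn_inv.comp_continuous (by fun_prop) hmem⟩
  have hγ (t : I) : T₁.toFun (γ t) = T₂.cover (line t) := T₁.right_inv _ (hmem t)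
  have hγ0 (t : I) : (γ t).2 ≠ 0 := by
    rw [Ne, ← T₁.mem_iff, hγ]
    exact (T₂.cover (line t)).2
  obtain ⟨Γ, hΓ⟩ := exists_log ⟨fun t => (γ t).2, by fun_prop⟩ hγ0
  -- `inv` depends only on the point of `S3`, so the loop also closes up in the coordinates of `T₁`,
  -- and its logarithm changes by a multiple of 2πi.
  have hends : γ 0 = γ 1 := by
    change T₁.inv _ = T₁.inv _
    rw [hl0, hl1, T₂.cover_shift]
  let Λ : C(I, ℝ × ℂ) := ⟨fun t => ((γ t).1, Γ t), by fun_prop⟩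
  have hΛ (t : I) : T₁.cover (Λ t) = T₂.cover (line t) := by
    apply Subtype.ext
    rw [← hγ]
    change T₁.toFun (_, Complex.exp (Γ t)) = _
    rw [hΓ]
    rfl
  obtain ⟨n, hn⟩ : ∃ n : ℤ, Λ 1 = shift n (Λ 0) := by
    have : Complex.exp (Γ 1) = Complex.exp (Γ 0) := by
      rw [hΓ, hΓ]
      exact congrArg Prod.snd hends.symm
    obtain ⟨n, hn⟩ := Complex.exp_eq_exp_iff_exists_int.1 this
    exact ⟨n, Prod.ext (show (γ 1).1 = (γ 0).1 from congrArg Prod.fst hends.symm) hn⟩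
  refine ⟨n, fun G _ H => ?_⟩
  have key : H.dev T₂.cover u (shift 1 u) = H.dev T₁.cover (Λ 0) (Λ 1) := by
    rw [← hl1, ← hl0]
    let p : Path (line 0) (line 1) := ⟨line, rfl, rfl⟩
    rw [H.dev_eq T₂.cover p]
    exact H.hol_eq_dev T₁.cover _ Λ hΛ
  refine (T₂.isConj_meridianHol H u).trans ?_
  rw [key, hn, H.dev_shift _ T₁.cover_shift]
  exact (isConj_zpow (T₁.isConj_meridianHol H (Λ 0)) n).symm

end Tube

/-! ### The standard tube -/

section squash

variable {E : Type*} [NormedAddCommGroup E] [NormedSpace ℝ E]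

/-- A homeomorphism from a normed space to its unit ball. -/
def squash (x : E) : E := (1 + ‖x‖)⁻¹ • x

/-- The inverse of `squash`. -/
def unsquash (x : E) : E := (1 - ‖x‖)⁻¹ • x

theorem one_add_norm_pos (x : E) : 0 < 1 + ‖x‖ := by positivity

theorem continuous_squash : Continuous (squash : E → E) :=
  ((continuous_const.add continuous_norm).inv₀ fun x => (one_add_norm_pos x).ne').smul continuous_id

theorem norm_squash_lt (x : E) : ‖squash x‖ < 1 := by
  rw [squash, norm_smul, norm_inv, Real.norm_of_nonneg (one_add_norm_pos x).le,
    inv_mul_lt_one₀ (one_add_norm_pos x)]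
  linarith

theorem squash_eq_zero {x : E} : squash x = 0 ↔ x = 0 := by
  simp [squash, (one_add_norm_pos x).ne']

theorem squash_zero : squash (0 : E) = 0 := squash_eq_zero.2 rfl

theorem continuousOn_unsquash : ContinuousOn (unsquash : E → E) {x | ‖x‖ < 1} :=
  (((continuous_const.sub continuous_norm).continuousOn).inv₀
    fun x (hx : ‖x‖ < 1) => (sub_pos.2 hx).ne').smul continuousOn_id

theorem squash_unsquash {x : E} (hx : ‖x‖ < 1) : squash (unsquash x) = x := by
  have h : 0 < 1 - ‖x‖ := by linarith
  have h2 : ‖unsquash x‖ = (1 - ‖x‖)⁻¹ * ‖x‖ := by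
    rw [unsquash, norm_smul, norm_inv, Real.norm_of_nonneg h.le]
  have h3 : 1 + (1 - ‖x‖)⁻¹ * ‖x‖ = (1 - ‖x‖)⁻¹ := by field_simp; ring
  rw [squash, h2, h3, unsquash, inv_inv, smul_smul, mul_inv_cancel₀ h.ne', one_smul]

end squash

/-- The point at cylindrical coordinates near the middle of the first unit of column `0`. -/
def cylPoint (v : ℝ × ℂ) : E3 := !₂[v.2.re / 4, 1 / 2 + v.1 / 4, 1 + v.2.im / 4]

/-- The cylindrical coordinates around the middle of the first unit of column `0`. -/
def cylCoord (p : E3) : ℝ × ℂ := (4 * (p 1 - 1 / 2), ⟨4 * p 0, 4 * (p 2 - 1)⟩)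

theorem cylPoint_cylCoord (p : E3) : cylPoint (cylCoord p) = p := by
  ext i
  fin_cases i <;> simp [cylPoint, cylCoord] <;> ring

theorem continuous_cylPoint : Continuous cylPoint := by
  refine (PiLp.continuous_toLp 2 _).comp (continuous_pi fun i => ?_)
  fin_cases i <;> simp <;> fun_prop

theorem continuous_cylCoord : Continuous cylCoord := by
  refine Continuous.prodMk (by fun_prop) ?_
  have : (fun p : E3 => (⟨4 * p 0, 4 * (p 2 - 1)⟩ : ℂ)) =
      fun p : E3 => ((4 * p 0 : ℝ) : ℂ) + ((4 * (p 2 - 1) : ℝ) : ℂ) * Complex.I := by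
    ext p; exact (Complex.mk_eq_add_mul_I _ _)
  rw [this]
  fun_prop

theorem cylPoint_mem_knot {v : ℝ × ℂ} (h1 : ‖v.1‖ < 1) (h2 : ‖v.2‖ < 1) :
    (cylPoint v : S3) ∈ figureEightKnot ↔ v.2 = 0 := by
  have hre := (Complex.abs_re_le_norm v.2).trans_lt h2
  have him := (Complex.abs_im_le_norm v.2).trans_lt h2
  rw [Real.norm_eq_abs] at h1
  have e0 : cylPoint v 0 = v.2.re / 4 := rfl
  have e1 : cylPoint v 1 = 1 / 2 + v.1 / 4 := rfl
  have e2 : cylPoint v 2 = 1 + v.2.im / 4 := rfl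
  rw [abs_lt] at hre him h1
  rw [mem_knot_near, e0, e2, Complex.ext_iff]
  · simp
  all_goals rw [abs_lt]
  · rw [e0]; constructor <;> linarith
  · rw [e1]; constructor <;> linarith
  · rw [e2]; constructor <;> linarith

/-- The standard tube around the first unit of column `0`. -/
def stdTube : Tube where
  -- Squashing both factors into unit balls keeps the tube where the knot is a straight line.
  toFun := ⟨fun v => (cylPoint (squash v.1, squash v.2) : S3), OnePoint.continuous_coe.comp
    (continuous_cylPoint.comp ((continuous_squash.comp continuous_fst).prodMk
      (continuous_squash.comp continuous_snd)))⟩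
  mem_iff v := (cylPoint_mem_knot (norm_squash_lt _) (norm_squash_lt _)).trans squash_eq_zero
  inv x := x.elim 0 fun p => (unsquash (cylCoord p).1, unsquash (cylCoord p).2)
  nhd := (↑) '' {p : E3 | ‖(cylCoord p).1‖ < 1 ∧ ‖(cylCoord p).2‖ < 1}
  isOpen_nhd := OnePoint.isOpen_image_coe.2 <|
    (isOpen_lt (continuous_cylCoord.fst.norm) continuous_const).inter
      (isOpen_lt (continuous_cylCoord.snd.norm) continuous_const)
  mem_nhd := by
    refine ⟨_, ?_, rfl⟩
    have : cylCoord (cylPoint (squash 0, squash 0)) = 0 := by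
      simp [squash_zero, cylCoord, cylPoint]
      rfl
    simp [this]
  right_inv := by
    rintro _ ⟨p, ⟨h1, h2⟩, rfl⟩
    change ((cylPoint (squash (unsquash (cylCoord p).1), squash (unsquash (cylCoord p).2)) : E3)
      : S3) = p
    rw [squash_unsquash h1, squash_unsquash h2, Prod.mk.eta, cylPoint_cylCoord]
  continuousOn_inv := by
    rintro _ ⟨p, ⟨h1, h2⟩, rfl⟩
    apply ContinuousAt.continuousWithinAt
    rw [← OnePoint.isOpenEmbedding_coe.continuousAt_iff]
    have a1 : ContinuousAt (unsquash : ℝ → ℝ) (cylCoord p).1 := continuousOn_unsquash.continuousAt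
      ((isOpen_lt continuous_norm continuous_const).mem_nhds h1)
    have a2 : ContinuousAt (unsquash : ℂ → ℂ) (cylCoord p).2 := continuousOn_unsquash.continuousAt
      ((isOpen_lt continuous_norm continuous_const).mem_nhds h2)
    exact (a1.comp (f := fun p => (cylCoord p).1) continuous_cylCoord.fst.continuousAt).prodMk
      (a2.comp (f := fun p => (cylCoord p).2) continuous_cylCoord.snd.continuousAt)

theorem stdTube_cover_angle (θ : ℝ) : (stdTube.cover (0, θ * Complex.I) : S3) =
    (!₂[Real.cos θ / 8, 1 / 2, 1 + Real.sin θ / 8] : E3) := by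
  change ((cylPoint (squash (0 : ℝ), squash (Complex.exp (θ * Complex.I))) : E3) : S3) = _
  congr 1
  have h : squash (Complex.exp (θ * Complex.I)) = (1 / 2 : ℝ) • Complex.exp (θ * Complex.I) := by
    rw [squash, Complex.norm_exp_ofReal_mul_I]; norm_num
  rw [h, squash_zero]
  ext i
  fin_cases i <;> simp [cylPoint, Complex.exp_ofReal_mul_I_re, Complex.exp_ofReal_mul_I_im] <;> ring

theorem onColumn_of_abs_lt {x y : ℝ} (h : OnColumn x y) (hx : |x| < 1) : x = 0 := by
  obtain ⟨k, hk, -⟩ := h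
  rw [hk] at hx ⊢
  rw [Nat.abs_cast] at hx
  have : (k : ℕ) < 1 := by exact_mod_cast hx
  have : (k : ℕ) = 0 := by omega
  simp [this]

theorem not_onColumn_half (y : ℝ) : ¬ OnColumn (1 / 2) y := by
  rintro ⟨k, hk, -⟩
  have : ((2 * (k : ℕ) : ℕ) : ℝ) = (1 : ℕ) := by push_cast; linarith
  have := Nat.cast_injective this
  omega

/-- On this arc the circle meets the plane of column 0 only at angle π/2, above the box. -/
theorem stdTube_mem_top {θ : ℝ} (h1 : -1 ≤ θ) (h2 : θ ≤ Real.pi) :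
    (stdTube.cover (0, θ * Complex.I) : S3) ∈ Chart.top.dom := by
  rw [stdTube_cover_angle]
  rintro ⟨p, ⟨hp, hb⟩, hpe⟩
  obtain rfl := OnePoint.coe_injective hpe
  have e0 : (!₂[Real.cos θ / 8, 1 / 2, 1 + Real.sin θ / 8] : E3) 0 = Real.cos θ / 8 := rfl
  have e2 : (!₂[Real.cos θ / 8, 1 / 2, 1 + Real.sin θ / 8] : E3) 2 = 1 + Real.sin θ / 8 := rfl
  have hs := Real.neg_one_le_sin θ
  have hc := Real.abs_cos_le_one θ
  have hb2 := hb.2.2.2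
  rw [e2] at hb2
  rw [e0, e2] at hp
  rcases hp with hp | hp
  · have h0 := onColumn_of_abs_lt hp (by rw [abs_div]; norm_num; linarith)
    have hcos : Real.cos θ = 0 := by linarith
    have hsq := Real.sin_sq_add_cos_sq θ
    have hpi := Real.pi_gt_three
    by_cases h : 0 ≤ θ
    · have := Real.sin_nonneg_of_nonneg_of_le_pi h h2
      have : Real.sin θ = 0 := by linarith
      simp [hcos, this] at hsq
    · have := Real.cos_pos_of_mem_Ioo ⟨by linarith, by linarith⟩ (x := θ)
      linarith
  · linarith

/-- No row has second coordinate 1/2, and on this arc height 1 occurs only at angle π, to the left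
of the box. -/
theorem stdTube_mem_low {θ : ℝ} (h1 : Real.pi ≤ θ) (h2 : θ ≤ 2 * Real.pi - 1) :
    (stdTube.cover (0, θ * Complex.I) : S3) ∈ Chart.low.dom := by
  rw [stdTube_cover_angle]
  rintro ⟨p, ⟨hp, hb⟩, hpe⟩
  obtain rfl := OnePoint.coe_injective hpe
  have e0 : (!₂[Real.cos θ / 8, 1 / 2, 1 + Real.sin θ / 8] : E3) 0 = Real.cos θ / 8 := rfl
  have e1 : (!₂[Real.cos θ / 8, 1 / 2, 1 + Real.sin θ / 8] : E3) 1 = 1 / 2 := rfl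
  have e2 : (!₂[Real.cos θ / 8, 1 / 2, 1 + Real.sin θ / 8] : E3) 2 = 1 + Real.sin θ / 8 := rfl
  have hb0 := hb.1.1
  rw [e0] at hb0
  rw [e1, e2] at hp
  rcases hp with hp | hp
  · exact not_onColumn_half _ hp
  · rcases h1.eq_or_lt with rfl | h1
    · rw [Real.cos_pi] at hb0; linarith
    · have : Real.sin θ = -Real.sin (θ - Real.pi) := by rw [Real.sin_sub_pi, neg_neg]
      have := Real.sin_pos_of_pos_of_lt_pi (x := θ - Real.pi) (by linarith) (by linarith)
      linarith

/-- The arc of the circle of radius one in the universal covering of a tube. -/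
def arc (θ φ : ℝ) : Path ((0 : ℝ), (θ : ℂ) * Complex.I) (0, (φ : ℂ) * Complex.I) where
  toFun t := (0, ((θ + t * (φ - θ) : ℝ) : ℂ) * Complex.I)
  source' := by simp
  target' := by simp

/-- The points at angles -1 and π lie in both charts. The first is inside the cell (0, 0), with
label `a`; at the second the top section is 1. -/
theorem isConj_stdTube {G : Type*} [Group G] (a b : G)
    (hR : b⁻¹ * a⁻¹ * b * a⁻¹ * b⁻¹ * a * b * a⁻¹ * b * a = 1) :
    IsConj (stdTube.meridianHol (knotSystem a b hR).holonomy) a := by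
  refine (stdTube.isConj_meridianHol _ (0, ((-1 : ℝ) : ℂ) * Complex.I)).trans ?_
  have hpi := Real.pi_gt_three
  have e1 : shift 1 (0, ((-1 : ℝ) : ℂ) * Complex.I) =
      (0, ((2 * Real.pi - 1 : ℝ) : ℂ) * Complex.I) := by
    rw [shift_apply]; push_cast; congr 1; ring
  rw [e1, ← Holonomy.dev_mul _ _ _ (0, (Real.pi : ℂ) * Complex.I),
    Holonomy.dev_eq _ _ (arc (-1) Real.pi), Holonomy.dev_eq _ _ (arc Real.pi (2 * Real.pi - 1)),
    (knotSystem a b hR).hol_of_forall_mem ((arc (-1) Real.pi).map stdTube.cover.continuous) Chart.top (fun t => stdTube_mem_top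
      (by nlinarith [t.2.1]) (by nlinarith [t.2.2])),
    (knotSystem a b hR).hol_of_forall_mem ((arc Real.pi (2 * Real.pi - 1)).map stdTube.cover.continuous)
      Chart.low (fun t => stdTube_mem_low
      (by nlinarith [t.2.1]) (by nlinarith [t.2.2]))]
  have s1 : (knotSystem a b hR).sec Chart.top (stdTube.cover (0, (Real.pi : ℂ) * Complex.I)) =
      1 := by
    change Chart.sec a b Chart.top (stdTube.cover (0, (Real.pi : ℂ) * Complex.I) : S3) = 1
    rw [stdTube_cover_angle]
    exact if_neg fun h => by
      have h2 : (!₂[Real.cos Real.pi / 8, 1 / 2, 1 + Real.sin Real.pi / 8] : E3) 2 < 1 := h.2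
      simp at h2
  have s2 : (knotSystem a b hR).sec Chart.top (stdTube.cover (0, ((-1 : ℝ) : ℂ) * Complex.I)) =
      a := by
    change Chart.sec a b Chart.top (stdTube.cover (0, ((-1 : ℝ) : ℂ) * Complex.I) : S3) = a
    rw [stdTube_cover_angle]
    have hs : 0 < Real.sin 1 := Real.sin_pos_of_pos_of_lt_pi (by norm_num) (by linarith)
    have hs1 := Real.sin_le_one 1
    have hc : 0 < Real.cos 1 := Real.cos_one_pos
    have hc1 := Real.cos_le_one 1
    rw [Chart.sec_top_coe]
    · have f0 : ⌊(!₂[Real.cos (-1) / 8, 1 / 2, 1 + Real.sin (-1) / 8] : E3) 0⌋ = 0 := by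
        rw [Int.floor_eq_iff]
        simp only [Matrix.cons_val_zero, Real.cos_neg]
        norm_num
        constructor <;> linarith
      have f1 : ⌊(!₂[Real.cos (-1) / 8, 1 / 2, 1 + Real.sin (-1) / 8] : E3) 1⌋ = 0 := by
        rw [Int.floor_eq_iff]
        simp only [Matrix.cons_val_one, Matrix.cons_val_zero]
        norm_num
      rw [f0, f1]
      rfl
    · change 0 < 1 + Real.sin (-1) / 8 ∧ 1 + Real.sin (-1) / 8 < 1
      rw [Real.sin_neg]
      constructor <;> linarith
  rw [s1, s2]
  change IsConj (1⁻¹ * 1 * (1⁻¹ * a)) a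
  rw [inv_one, one_mul, one_mul, one_mul]

/-! ### The tube given by a tubular neighbourhood -/

namespace TubularNbhd

variable {K : Set S3} (N : TubularNbhd K)

theorem mem_iff (q : Circle × ℂ) : N.toFun q ∈ K ↔ q.2 = 0 := by
  have h : N.toFun q ∈ N.toFun '' {p | p.2 = 0} ↔ q.2 = 0 :=
    N.isOpenEmbedding.injective.mem_set_image
  rwa [N.image_core] at h

/-- The coordinates of a point in the tubular neighbourhood. -/
def coords (x : S3) : Circle × ℂ := Function.invFun N.toFun x

@[simp] theorem coords_toFun (q : Circle × ℂ) : N.coords (N.toFun q) = q :=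
  Function.leftInverse_invFun N.isOpenEmbedding.injective q

theorem continuousAt_coords (q : Circle × ℂ) : ContinuousAt N.coords (N.toFun q) := by
  rw [← N.isOpenEmbedding.continuousAt_iff]
  have : N.coords ∘ N.toFun = id := funext N.coords_toFun
  rw [this]
  exact continuousAt_id

/-- The points of the circle close to a given one. -/
def nearPoints (s : Circle) : Set Circle := {z | ((z / s : Circle) : ℂ) ∈ Complex.slitPlane}

theorem isOpen_nearPoints (s : Circle) : IsOpen (nearPoints s) :=
  Complex.isOpen_slitPlane.preimage (by fun_prop)

theorem mem_nearPoints_self (s : Circle) : s ∈ nearPoints s := by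
  simp [nearPoints]

theorem continuousAt_arg_div {s z : Circle} (hz : z ∈ nearPoints s) :
    ContinuousAt (fun z : Circle => Complex.arg ((z / s : Circle) : ℂ)) z :=
  (Complex.continuousAt_arg hz).comp (f := fun z : Circle => ((z / s : Circle) : ℂ))
    (by fun_prop)

theorem exp_add_arg_div (x : ℝ) (z : Circle) :
    Circle.exp (x + Complex.arg ((z / Circle.exp x : Circle) : ℂ)) = z := by
  rw [Circle.exp_add, Circle.exp_arg, mul_div_cancel]

end TubularNbhd

/-- The tube around the point with parameter `exp (ix)` of the knot. -/
def nbhdTube (N : TubularNbhd figureEightKnot) (x : ℝ) : Tube where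
  toFun := ⟨fun u => N.toFun (Circle.exp (x + u.1), u.2), N.isOpenEmbedding.continuous.comp
    (by fun_prop)⟩
  mem_iff u := N.mem_iff _
  inv y := (Complex.arg ((N.coords y).1 / Circle.exp x : Circle), (N.coords y).2)
  nhd := N.toFun '' (TubularNbhd.nearPoints (Circle.exp x) ×ˢ univ)
  isOpen_nhd := N.isOpenEmbedding.isOpenMap _
    ((TubularNbhd.isOpen_nearPoints _).prod isOpen_univ)
  mem_nhd := ⟨(Circle.exp x, 0), ⟨TubularNbhd.mem_nearPoints_self _, trivial⟩, by simp⟩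
  right_inv := by
    rintro _ ⟨⟨z, w⟩, -, rfl⟩
    change N.toFun (Circle.exp (x + _), _) = _
    rw [N.coords_toFun, TubularNbhd.exp_add_arg_div]
  continuousOn_inv := by
    rintro _ ⟨⟨z, w⟩, ⟨hz, -⟩, rfl⟩
    apply ContinuousAt.continuousWithinAt
    have h := N.continuousAt_coords (z, w)
    refine ContinuousAt.prodMk ?_ h.snd
    refine ContinuousAt.comp (g := fun z : Circle => Complex.arg ((z / Circle.exp x : Circle) : ℂ))
      (f := fun y => (N.coords y).1) ?_ h.fst
    rw [N.coords_toFun]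
    exact TubularNbhd.continuousAt_arg_div hz

theorem exists_parameter (N : TubularNbhd figureEightKnot) :
    ∃ x : ℝ, (nbhdTube N x).toFun (0, 0) = stdTube.toFun (0, 0) := by
  have h : stdTube.toFun (0, 0) ∈ figureEightKnot := (stdTube.mem_iff _).2 rfl
  rw [← N.image_core] at h
  obtain ⟨⟨s, w⟩, rfl, hs⟩ := h
  refine ⟨Complex.arg s, ?_⟩
  rw [← hs]
  simp [nbhdTube]

theorem isConj_nbhdTube (N : TubularNbhd figureEightKnot) (x : ℝ)
    (hx : (nbhdTube N x).toFun (0, 0) = stdTube.toFun (0, 0)) :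
    ∃ n : ℤ, (n = 1 ∨ n = -1) ∧ ∀ (G : Type) [Group G] (a b : G)
      (hR : b⁻¹ * a⁻¹ * b * a⁻¹ * b⁻¹ * a * b * a⁻¹ * b * a = 1),
      IsConj ((nbhdTube N x).meridianHol (knotSystem a b hR).holonomy) (a ^ n) := by
  obtain ⟨m, hm⟩ := Tube.exists_isConj_zpow _ _ hx
  obtain ⟨n, hn⟩ := Tube.exists_isConj_zpow _ _ hx.symm
  refine ⟨n, ?_, fun G _ a b hR => ?_⟩
  -- The relation has exponent sum zero, so both generators may be sent to a generator of ℤ. There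
  -- conjugacy is equality, and the two exponents have product 1.
  · let g : Multiplicative ℤ := Multiplicative.ofAdd 1
    have hR : g⁻¹ * g⁻¹ * g * g⁻¹ * g⁻¹ * g * g * g⁻¹ * g * g = 1 := by group
    have h1 := isConj_iff_eq.1 (hm _ (knotSystem g g hR).holonomy)
    have h2 := isConj_iff_eq.1 (hn _ (knotSystem g g hR).holonomy)
    have h3 := isConj_iff_eq.1 (isConj_stdTube g g hR)
    rw [h3] at h1 h2
    rw [h2, ← zpow_mul] at h1
    have h4 : (1 : ℤ) = n * m := by
      have := congrArg Multiplicative.toAdd h1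
      simpa [g] using this
    exact Int.eq_one_or_neg_one_of_mul_eq_one h4.symm
  · exact (hn _ _).trans (isConj_zpow (isConj_stdTube a b hR) n)

/-! ### Connectedness of the complement -/

theorem infty_notMem_knot : (OnePoint.infty : S3) ∉ figureEightKnot := by
  rintro ⟨p, -, h⟩
  exact OnePoint.coe_ne_infty p h

/-- A ray that starts at a given point of the complement and avoids the knot. -/
theorem exists_ray {p : E3} (hp : (p : S3) ∉ figureEightKnot) :
    ∃ v : E3, v ≠ 0 ∧ ∀ s : ℝ, ((p + s • v : E3) : S3) ∉ figureEightKnot := by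
  classical
  -- The edges seen from `p` span 24 subspaces of dimension at most 2; a direction outside all of
  -- them gives a line that misses the knot.
  let W : Fin 24 → Submodule ℝ E3 := fun i =>
    Submodule.span ℝ {figureEightVertex i - p, figureEightVertex (i + 1) - p}
  have hW : ⊤ ∉ Finset.univ.image W := by
    intro h
    obtain ⟨i, -, hi⟩ := Finset.mem_image.1 h
    have h1 : Module.finrank ℝ (W i) = 3 := by rw [hi, finrank_top]; simp
    have h2 := finrank_span_le_card (R := ℝ)
      ({figureEightVertex i - p, figureEightVertex (i + 1) - p} : Set E3)
    rw [show Submodule.span ℝ _ = W i from rfl, h1, Set.toFinset_insert,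
      Set.toFinset_singleton] at h2
    exact absurd (h2.trans Finset.card_le_two) (by norm_num)
  obtain ⟨v, hv⟩ := (Set.ne_univ_iff_exists_notMem _).1
    (Subspace.biUnion_ne_univ_of_top_notMem hW)
  have hv' (i : Fin 24) : v ∉ W i := fun h => hv (mem_biUnion
    (Finset.mem_image_of_mem W (Finset.mem_univ i)) h)
  refine ⟨v, fun h => hv' 0 (h ▸ zero_mem _), fun s hs => ?_⟩
  by_cases hs0 : s = 0
  · rw [hs0, zero_smul, add_zero] at hs
    exact hp hs
  · obtain ⟨i, hi⟩ := coe_mem_knot.1 hs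
    rw [segment_eq_image] at hi
    obtain ⟨t, -, ht⟩ := hi
    refine hv' i (((W i).smul_mem_iff hs0).1 ?_)
    have : s • v = (1 - t) • (figureEightVertex i - p) +
        t • (figureEightVertex (i + 1) - p) := by
      have h3 : s • v = (1 - t) • figureEightVertex i + t • figureEightVertex (i + 1) - p :=
        eq_sub_of_add_eq' ht.symm
      rw [h3]; module
    rw [this]
    exact add_mem ((W i).smul_mem _ (Submodule.subset_span (by simp)))
      ((W i).smul_mem _ (Submodule.subset_span (by simp)))

theorem joined_infty {p : E3} (hp : (p : S3) ∉ figureEightKnot) :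
    Joined (⟨p, hp⟩ : KnotCompl) ⟨OnePoint.infty, infty_notMem_knot⟩ := by
  obtain ⟨v, hv0, hv⟩ := exists_ray hp
  -- The parameter is 0 at t = 0 and tends to infinity in norm as t → 1.
  let g : ℝ → S3 := fun t => ((p + ((1 - t)⁻¹ - 1) • v : E3) : S3)
  let f : ℝ → S3 := Function.update g 1 OnePoint.infty
  have hf : Continuous f := by
    rw [continuous_iff_continuousAt]
    intro t
    by_cases ht : t = 1
    · subst ht
      rw [continuousAt_update_same]
      refine OnePoint.tendsto_coe_infty.comp ?_
      rw [coclosedCompact_eq_cocompact, ← Metric.cobounded_eq_cocompact]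
      rw [← tendsto_norm_atTop_iff_cobounded]
      have h1 : Tendsto (fun t : ℝ => ‖(1 - t)⁻¹‖) (𝓝[≠] 1) atTop := by
        rw [tendsto_norm_atTop_iff_cobounded]
        refine tendsto_inv₀_nhdsNE_zero.comp ?_
        refine tendsto_nhdsWithin_iff.2 ⟨?_, ?_⟩
        · refine Tendsto.mono_left ?_ nhdsWithin_le_nhds
          have : Continuous fun t : ℝ => 1 - t := by fun_prop
          simpa using this.tendsto 1
        · filter_upwards [self_mem_nhdsWithin] with t ht
          exact sub_ne_zero.2 (Ne.symm ht)
      have h2 : Tendsto (fun t : ℝ => ‖(1 - t)⁻¹‖ * ‖v‖ + (-‖p - v‖)) (𝓝[≠] 1) atTop :=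
        tendsto_atTop_add_const_right _ _ (h1.atTop_mul_const (norm_pos_iff.2 hv0))
      refine tendsto_atTop_mono (fun t => ?_) h2
      have h3 : p + ((1 - t)⁻¹ - 1) • v = (1 - t)⁻¹ • v - -(p - v) := by module
      rw [h3, ← norm_smul, ← norm_neg (p - v), ← sub_eq_add_neg]
      exact norm_sub_norm_le _ _
    · rw [continuousAt_update_of_ne ht]
      refine OnePoint.continuous_coe.continuousAt.comp ?_
      have : ContinuousAt (fun t : ℝ => (1 - t)⁻¹) t :=
        ContinuousAt.inv₀ (by fun_prop) (sub_ne_zero.2 (Ne.symm ht))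
      fun_prop
  have hK (t : ℝ) : f t ∉ figureEightKnot := by
    by_cases ht : t = 1
    · rw [ht, show f 1 = OnePoint.infty from Function.update_self ..]
      exact infty_notMem_knot
    · rw [show f t = g t from Function.update_of_ne ht ..]
      exact hv _
  refine ⟨⟨⟨fun t => ⟨f t, hK t⟩, by fun_prop⟩, ?_, ?_⟩⟩
  · apply Subtype.ext
    change f (0 : ℝ) = _
    rw [show f 0 = g 0 from Function.update_of_ne zero_ne_one ..]
    simp [g]
  · apply Subtype.ext
    change f (1 : ℝ) = _
    exact Function.update_self ..

instance : PathConnectedSpace KnotCompl := by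
  have h (x : KnotCompl) : Joined x ⟨OnePoint.infty, infty_notMem_knot⟩ := by
    obtain ⟨x, hx⟩ := x
    induction x using OnePoint.rec with
    | infty => exact Joined.refl _
    | coe p => exact joined_infty hx
  exact ⟨⟨⟨OnePoint.infty, infty_notMem_knot⟩⟩, fun x y => (h x).trans (h y).symm⟩

/-! ### The radial deformation of the complement onto the exterior -/

namespace TubularNbhd

variable {K : Set S3} (N : TubularNbhd K)

theorem notMem_of_exterior (x : N.Exterior) : (x : S3) ∉ K := by
  intro hx
  obtain ⟨q, hq, hqx⟩ := (Set.ext_iff.1 N.image_core x).2 hx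
  have h0 : q.2 = 0 := hq
  exact x.2 ⟨q, show ‖q.2‖ < 1 by simp [h0], hqx⟩

/-- The inclusion of the exterior into the complement of the knot. -/
def incl : C(N.Exterior, {x : S3 // x ∉ K}) where
  toFun x := ⟨x, N.notMem_of_exterior x⟩
  continuous_toFun := continuous_subtype_val.subtype_mk _

/-- The closed solid torus around the knot. -/
def closedSolidTorus : Set S3 := N.toFun '' {q | ‖q.2‖ ≤ 1}

theorem isClosed_closedSolidTorus : IsClosed N.closedSolidTorus := by
  have h : IsCompact {q : Circle × ℂ | ‖q.2‖ ≤ 1} := by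
    have : {q : Circle × ℂ | ‖q.2‖ ≤ 1} = univ ×ˢ Metric.closedBall 0 1 := by
      ext q; simp
    rw [this]
    exact isCompact_univ.prod (isCompact_closedBall 0 1)
  exact (h.image N.isOpenEmbedding.continuous).isClosed

/-- The radial factor of the deformation. -/
def radial (s : ℝ) (w : ℂ) : ℂ := ((1 - s + s * max 1 ‖w‖⁻¹ : ℝ) : ℂ) * w

theorem radial_of_one_le (s : ℝ) {w : ℂ} (hw : 1 ≤ ‖w‖) : radial s w = w := by
  rw [radial, max_eq_left (inv_le_one_of_one_le₀ hw)]
  simp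

theorem radial_zero (w : ℂ) : radial 0 w = w := by simp [radial]

theorem radial_ne_zero {s : ℝ} (h0 : 0 ≤ s) {w : ℂ} (hw : w ≠ 0) : radial s w ≠ 0 := by
  refine mul_ne_zero (Complex.ofReal_ne_zero.2 (ne_of_gt ?_)) hw
  nlinarith [le_max_left 1 ‖w‖⁻¹]

/-- At `s = 1` the factor is `max 1 ‖w‖⁻¹`: the punctured disc is pushed onto the unit circle. -/
theorem one_le_norm_radial_one {w : ℂ} (hw : w ≠ 0) : 1 ≤ ‖radial 1 w‖ := by
  have h : 0 < ‖w‖ := norm_pos_iff.2 hw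
  rw [radial, norm_mul, Complex.norm_real, Real.norm_of_nonneg (by positivity)]
  calc (1 : ℝ) = ‖w‖⁻¹ * ‖w‖ := (inv_mul_cancel₀ h.ne').symm
    _ ≤ _ := by gcongr; simp

theorem continuousAt_radial (s : ℝ) {w : ℂ} (hw : w ≠ 0) :
    ContinuousAt (fun q : ℝ × ℂ => radial q.1 q.2) (s, w) := by
  have h : ContinuousAt (fun q : ℝ × ℂ => ‖q.2‖⁻¹) (s, w) :=
    ContinuousAt.inv₀ (by fun_prop) (norm_ne_zero_iff.2 hw)
  have h2 : ContinuousAt (fun q : ℝ × ℂ => (1 - q.1 + q.1 * max 1 ‖q.2‖⁻¹ : ℝ)) (s, w) := by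
    fun_prop
  exact (Complex.continuous_ofReal.continuousAt.comp h2).mul continuousAt_snd

open Classical in
/-- The radial deformation. -/
def deform (s : ℝ) (x : S3) : S3 :=
  if x ∈ range N.toFun then N.toFun ((N.coords x).1, radial s (N.coords x).2) else x

theorem deform_toFun (s : ℝ) (q : Circle × ℂ) : N.deform s (N.toFun q) =
    N.toFun (q.1, radial s q.2) := by
  rw [deform, if_pos ⟨q, rfl⟩, coords_toFun]

theorem deform_of_exterior (s : ℝ) {x : S3} (hx : x ∉ N.openSolidTorus) : N.deform s x = x := by
  by_cases h : x ∈ range N.toFun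
  · obtain ⟨q, rfl⟩ := h
    rw [deform_toFun, radial_of_one_le]
    by_contra hc
    exact hx ⟨q, not_le.1 hc, rfl⟩
  · rw [deform, if_neg h]

theorem deform_zero (x : S3) : N.deform 0 x = x := by
  by_cases h : x ∈ range N.toFun
  · obtain ⟨q, rfl⟩ := h
    rw [deform_toFun, radial_zero]
  · rw [deform, if_neg h]

theorem deform_notMem {s : ℝ} (h0 : 0 ≤ s) {x : S3} (hx : x ∉ K) : N.deform s x ∉ K := by
  by_cases h : x ∈ range N.toFun
  · obtain ⟨q, rfl⟩ := h
    rw [deform_toFun, mem_iff]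
    rw [mem_iff] at hx
    exact radial_ne_zero h0 hx
  · rwa [deform, if_neg h]

theorem deform_one_notMem {x : S3} (hx : x ∉ K) : N.deform 1 x ∉ N.openSolidTorus := by
  by_cases h : x ∈ range N.toFun
  · obtain ⟨q, rfl⟩ := h
    rw [deform_toFun]
    rw [mem_iff] at hx
    rintro ⟨q', hq', he⟩
    obtain rfl := N.isOpenEmbedding.injective he
    exact absurd hq' (not_lt.2 (one_le_norm_radial_one hx))
  · rw [deform, if_neg h]
    rintro ⟨q, -, rfl⟩
    exact h ⟨q, rfl⟩

/-- Two open sets suffice: the range of the neighbourhood, with a formula in coordinates, and the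
complement of the compact solid torus, where nothing moves. -/
theorem continuous_deform : Continuous fun q : ℝ × {x : S3 // x ∉ K} => N.deform q.1 q.2 := by
  rw [continuous_iff_continuousAt]
  rintro ⟨s, x, hx⟩
  by_cases h : x ∈ range N.toFun
  · obtain ⟨⟨z, w⟩, rfl⟩ := h
    have hw : w ≠ 0 := fun h => hx ((N.mem_iff _).2 h)
    have hc : ContinuousAt (fun q : ℝ × {x : S3 // x ∉ K} => N.coords q.2)
        (s, ⟨N.toFun (z, w), hx⟩) :=
      ContinuousAt.comp (g := N.coords) (f := fun q : ℝ × {x : S3 // x ∉ K} => (q.2 : S3))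
        (N.continuousAt_coords _) (by fun_prop)
    have hr : ContinuousAt (fun q : ℝ × {x : S3 // x ∉ K} => radial q.1 (N.coords q.2).2)
        (s, ⟨N.toFun (z, w), hx⟩) := by
      refine ContinuousAt.comp (g := fun q : ℝ × ℂ => radial q.1 q.2)
        (f := fun q : ℝ × {x : S3 // x ∉ K} => (q.1, (N.coords q.2).2)) ?_
        (continuousAt_fst.prodMk hc.snd)
      rw [N.coords_toFun]
      exact continuousAt_radial s hw
    refine (N.isOpenEmbedding.continuous.continuousAt.comp (hc.fst.prodMk hr)).congr ?_
    have ho : ∀ᶠ q : ℝ × {x : S3 // x ∉ K} in 𝓝 (s, ⟨N.toFun (z, w), hx⟩),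
        (q.2 : S3) ∈ range N.toFun :=
      (continuous_subtype_val.comp continuous_snd).continuousAt.preimage_mem_nhds
        (N.isOpenEmbedding.isOpen_range.mem_nhds ⟨_, rfl⟩)
    filter_upwards [ho] with q hq
    exact (if_pos hq).symm
  · have hc : x ∉ N.closedSolidTorus := by
      rintro ⟨q, -, rfl⟩
      exact h ⟨q, rfl⟩
    have ho : ∀ᶠ q : ℝ × {x : S3 // x ∉ K} in 𝓝 (s, ⟨x, hx⟩),
        (q.2 : S3) ∈ N.closedSolidTorusᶜ :=
      (continuous_subtype_val.comp continuous_snd).continuousAt.preimage_mem_nhds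
        (N.isClosed_closedSolidTorus.isOpen_compl.mem_nhds hc)
    refine ContinuousAt.congr (f := fun q : ℝ × {x : S3 // x ∉ K} => (q.2 : S3)) (by fun_prop) ?_
    filter_upwards [ho] with q hq
    refine (N.deform_of_exterior _ fun hq' => hq ?_).symm
    obtain ⟨r, hr, he⟩ := hq'
    exact ⟨r, (show ‖r.2‖ < 1 from hr).le, he⟩

/-- Paths in the complement of the knot can be pushed into the exterior. -/
theorem exists_path_exterior {x y : N.Exterior} (p : Path (N.incl x) (N.incl y)) :
    ∃ q : Path x y, p.Homotopic (q.map N.incl.continuous) := by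
  have hp : Continuous fun u : I × I => N.deform u.1 (p u.2) :=
    N.continuous_deform.comp (f := fun u : I × I => ((u.1 : ℝ), p u.2)) (by fun_prop)
  have hp1 : Continuous fun t : I => N.deform 1 (p t) :=
    N.continuous_deform.comp (f := fun t : I => ((1 : ℝ), p t)) (by fun_prop)
  let q : Path x y :=
    { toFun := fun t => ⟨N.deform 1 (p t), N.deform_one_notMem (p t).2⟩
      continuous_toFun := hp1.subtype_mk _
      source' := by
        apply Subtype.ext
        change N.deform 1 (p 0) = x
        rw [p.source]
        exact N.deform_of_exterior 1 x.2
      target' := by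
        apply Subtype.ext
        change N.deform 1 (p 1) = y
        rw [p.target]
        exact N.deform_of_exterior 1 y.2 }
  refine ⟨q, ⟨⟨⟨⟨fun u => ⟨N.deform u.1 (p u.2), N.deform_notMem u.1.2.1 (p u.2).2⟩,
    hp.subtype_mk _⟩, fun t => ?_, fun t => ?_⟩, ?_⟩⟩⟩
  · exact Subtype.ext (N.deform_zero _)
  · exact Subtype.ext rfl
  · rintro s t (rfl | rfl)
    · apply Subtype.ext
      change N.deform s (p 0) = p 0
      rw [p.source]
      exact N.deform_of_exterior s x.2
    · apply Subtype.ext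
      change N.deform s (p 1) = p 1
      rw [p.target]
      exact N.deform_of_exterior s y.2

end TubularNbhd

instance (N : TubularNbhd figureEightKnot) : PathConnectedSpace N.Exterior :=
  ⟨⟨N.basePoint⟩, fun x y => by
    obtain ⟨p⟩ := PathConnectedSpace.joined (N.incl x) (N.incl y)
    obtain ⟨q, -⟩ := N.exists_path_exterior p
    exact ⟨q⟩⟩

namespace TubularNbhd

/-! ### The peripheral torus -/

variable {K : Set S3} (N : TubularNbhd K)

/-- The universal covering of the complement of the core of a tubular neighbourhood. -/
def cover : C(ℝ × ℂ, {x : S3 // x ∉ K}) where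
  toFun u := ⟨N.toFun (Circle.exp u.1, Complex.exp u.2), by
    rw [N.mem_iff]; exact Complex.exp_ne_zero _⟩
  continuous_toFun := by
    refine Continuous.subtype_mk (N.isOpenEmbedding.continuous.comp ?_) _
    fun_prop

/-- The translation of `ℝ × ℂ` by `(2πn, 0)`. -/
def slide (n : ℤ) : C(ℝ × ℂ, ℝ × ℂ) where
  toFun u := (u.1 + n * (2 * Real.pi), u.2)
  continuous_toFun := by fun_prop

theorem slide_apply (n : ℤ) (u : ℝ × ℂ) : slide n u = (u.1 + n * (2 * Real.pi), u.2) := rfl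

theorem cover_shift (n : ℤ) (u : ℝ × ℂ) : N.cover (shift n u) = N.cover u := by
  apply Subtype.ext
  change N.toFun (_, Complex.exp (_ + _)) = N.toFun (_, Complex.exp _)
  rw [Complex.exp_add, Complex.exp_int_mul_two_pi_mul_I, mul_one]
  rfl

theorem cover_slide (n : ℤ) (u : ℝ × ℂ) : N.cover (slide n u) = N.cover u := by
  apply Subtype.ext
  change N.toFun (Circle.exp (_ + _), _) = N.toFun (Circle.exp _, _)
  rw [Circle.exp_add, Circle.exp_int_mul_two_pi, mul_one]
  rfl

variable {G : Type*} [Group G] (H : Holonomy {x : S3 // x ∉ K} G)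

/-- The holonomy along the meridian. -/
def meridianHol : G := H.dev N.cover 0 (shift 1 0)

/-- The holonomy along the parallel. -/
def longitudeHol : G := H.dev N.cover 0 (slide 1 0)

theorem hol_meridianLoop :
    H.hol (N.meridianLoop.map N.incl.continuous) = N.meridianHol H := by
  let Γ : C(I, ℝ × ℂ) := ⟨fun t => (0, ((2 * Real.pi * t : ℝ) : ℂ) * Complex.I), by fun_prop⟩
  rw [H.hol_eq_dev N.cover _ Γ]
  · rw [meridianHol]
    congr 1
    · simp [Γ]
    · simp [Γ, shift_apply]
  · intro t
    apply Subtype.ext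
    change N.toFun (Circle.exp 0, Complex.exp (((2 * Real.pi * t : ℝ) : ℂ) * Complex.I)) =
      N.toFun (1, (Circle.exp (2 * Real.pi * t) : ℂ))
    rw [Circle.exp_zero, Circle.coe_exp]

theorem hol_longitudeLoop :
    H.hol (N.longitudeLoop.map N.incl.continuous) = N.longitudeHol H := by
  let Γ : C(I, ℝ × ℂ) := ⟨fun t => (2 * Real.pi * t, 0), by fun_prop⟩
  rw [H.hol_eq_dev N.cover _ Γ]
  · rw [longitudeHol]
    congr 1
    · simp [Γ]
    · simp [Γ, slide_apply]
  · intro t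
    apply Subtype.ext
    change N.toFun (Circle.exp (2 * Real.pi * t), Complex.exp 0) =
      N.toFun (Circle.exp (2 * Real.pi * t), ((1 : Circle) : ℂ))
    rw [Complex.exp_zero, Circle.coe_one]

/-- The two deck translations commute, so both products develop from the origin to the same corner.
-/
theorem commute_longitudeHol_meridianHol : Commute (N.longitudeHol H) (N.meridianHol H) := by
  have h : slide 1 (shift 1 0) = shift 1 (slide 1 0) := rfl
  have h1 := H.dev_mul N.cover 0 (shift 1 0) (slide 1 (shift 1 0))
  have h2 := H.dev_mul N.cover 0 (slide 1 0) (slide 1 (shift 1 0))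
  rw [H.dev_comp N.cover (slide 1) (N.cover_slide 1)] at h2
  nth_rw 1 [h] at h1
  rw [H.dev_comp N.cover (shift 1) (N.cover_shift 1)] at h1
  exact h1.trans h2.symm

/-- The parallel section over the universal covering of the torus. -/
def flat (z : ℝ × ℂ) : G := H.dev N.cover 0 z

theorem flat_shift (n : ℤ) (z : ℝ × ℂ) :
    N.flat H (shift n z) = N.flat H z * N.meridianHol H ^ n := by
  rw [flat, ← H.dev_mul N.cover 0 (shift n 0),
    H.dev_comp N.cover (shift n) (N.cover_shift n), H.dev_shift _ N.cover_shift]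
  rfl

/-- Trivial longitude holonomy makes the parallel section periodic along the knot; this removes the
only obstruction to filling in the discs. -/
theorem flat_slide (h : N.longitudeHol H = 1) (n : ℤ) (z : ℝ × ℂ) :
    N.flat H (slide n z) = N.flat H z := by
  rw [flat, ← H.dev_mul N.cover 0 (slide n 0),
    H.dev_comp N.cover (slide n) (N.cover_slide n), H.dev_zpow N.cover slide _ _ N.cover_slide]
  · rw [show H.dev N.cover 0 (slide 1 0) = 1 from h, one_zpow, mul_one]
    rfl
  · intro m n u
    simp only [slide_apply]; push_cast; congr 1; ring
  · intro u
    simp [slide_apply]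

/-- Near `z` the straight segment stays in one chart, where holonomy is a quotient of values of the
section. -/
theorem parallel_flat {ι : Type*} (L : LocalSystem {x : S3 // x ∉ K} G ι) :
    L.Parallel N.cover (N.flat L.holonomy) := by
  intro z
  refine ⟨L.idx (N.cover z), L.mem_idx _, ?_⟩
  set i := L.idx (N.cover z)
  obtain ⟨ε, hε, hb⟩ := Metric.isOpen_iff.1 ((L.isOpen_U i).preimage N.cover.continuous) z
    (L.mem_idx _)
  filter_upwards [Metric.ball_mem_nhds z hε] with y hy
  let p : Path z y :=
    { toFun := fun t => AffineMap.lineMap z y (t : ℝ)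
      continuous_toFun := by
        simp only [AffineMap.lineMap_apply_module]
        fun_prop
      source' := by simp
      target' := by simp }
  have hp (t : I) : (p.map N.cover.continuous) t ∈ L.U i := by
    refine hb ((convex_ball z ε).lineMap_mem (Metric.mem_ball_self hε) hy t.2)
  have h := L.hol_of_forall_mem (p.map N.cover.continuous) i hp
  rw [← Holonomy.dev_eq] at h
  rw [flat, ← L.holonomy.dev_mul N.cover 0 z y, h, flat]
  group

end TubularNbhd

/-- The cover of `nbhdTube N x` is `N.cover` after a translation by `x`, so the two meridians are
developments of one deck transformation at different points. -/
theorem isConj_meridianHol (N : TubularNbhd figureEightKnot) {G : Type} [Group G] (a b : G)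
    (hR : b⁻¹ * a⁻¹ * b * a⁻¹ * b⁻¹ * a * b * a⁻¹ * b * a = 1) :
    ∃ n : ℤ, (n = 1 ∨ n = -1) ∧ IsConj (N.meridianHol (knotSystem a b hR).holonomy) (a ^ n) := by
  obtain ⟨x, hx⟩ := exists_parameter N
  obtain ⟨n, hn, h⟩ := isConj_nbhdTube N x hx
  refine ⟨n, hn, IsConj.trans ?_ (h G a b hR)⟩
  let T : C(ℝ × ℂ, ℝ × ℂ) := ⟨fun u => (x + u.1, u.2), by fun_prop⟩
  have h1 : (nbhdTube N x).meridianHol (knotSystem a b hR).holonomy =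
      (knotSystem a b hR).holonomy.dev N.cover (T 0) (shift 1 (T 0)) := by
    obtain ⟨p⟩ : Nonempty (Path (0 : ℝ × ℂ) (shift 1 0)) := ⟨PathConnectedSpace.somePath _ _⟩
    rw [Tube.meridianHol, Holonomy.dev_eq _ _ p]
    exact Holonomy.dev_eq _ N.cover (p.map T.continuous) |>.symm
  rw [h1]
  exact Holonomy.isConj_dev _ N.cover (shift 1) (N.cover_shift 1) _ _

namespace TubularNbhd

variable {K : Set S3} (N : TubularNbhd K)

/-! ### Branches of the logarithm -/

/-- The branch of the logarithm that is continuous around `z`. -/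
def logAt (z : Circle) (w : ℂ) : ℂ := Complex.log (w / z) + Complex.log z

/-- The difference between a branch of the logarithm and the principal branch. -/
def branch (z : Circle) (w : ℂ) : ℤ :=
  -- For `w ≠ 0` the quotient is already an integer, by `logAt_eq`; rounding only places it in ℤ.
  round ((logAt z w - Complex.log w).im / (2 * Real.pi))

/-- The directions close to a given one. -/
def sector (z : Circle) : Set ℂ := {w | w / z ∈ Complex.slitPlane}

theorem isOpen_sector (z : Circle) : IsOpen (sector z) :=
  Complex.isOpen_slitPlane.preimage (continuous_id.div_const _)

theorem mem_sector_self (z : Circle) : (z : ℂ) ∈ sector z := by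
  simp [sector]

theorem ne_zero_of_mem_sector {z : Circle} {w : ℂ} (h : w ∈ sector z) : w ≠ 0 := by
  rintro rfl
  simp [sector] at h

theorem exp_logAt (z : Circle) {w : ℂ} (hw : w ≠ 0) : Complex.exp (logAt z w) = w := by
  rw [logAt, Complex.exp_add, Complex.exp_log (div_ne_zero hw z.coe_ne_zero),
    Complex.exp_log z.coe_ne_zero, div_mul_cancel₀ _ z.coe_ne_zero]

theorem continuousAt_logAt {z : Circle} {w : ℂ} (hw : w ∈ sector z) :
    ContinuousAt (logAt z) w :=
  ((continuousAt_id.div_const _).clog hw).add continuousAt_const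

theorem logAt_eq (z : Circle) {w : ℂ} (hw : w ≠ 0) :
    logAt z w = Complex.log w + branch z w * (2 * Real.pi * Complex.I) := by
  obtain ⟨n, hn⟩ := Complex.exp_eq_exp_iff_exists_int.1
    ((exp_logAt z hw).trans (Complex.exp_log hw).symm)
  have : branch z w = n := by
    rw [branch, hn, add_sub_cancel_left]
    have : ((n : ℂ) * (2 * Real.pi * Complex.I)).im = n * (2 * Real.pi) := by simp
    rw [this, mul_div_cancel_right₀ _ (by positivity), round_intCast]
  rw [this, hn]

/-- The difference of two branches is continuous on both sectors and integral after division by 2πi.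
-/
theorem eventually_branch_sub {z z' : Circle} {w : ℂ} (h : w ∈ sector z) (h' : w ∈ sector z') :
    ∀ᶠ c in 𝓝 w, branch z c - branch z' c = branch z w - branch z' w := by
  have key {c : ℂ} (hc : c ≠ 0) : ((branch z c - branch z' c : ℤ) : ℝ) =
      (logAt z c - logAt z' c).im / (2 * Real.pi) := by
    have : logAt z c - logAt z' c =
        ((branch z c - branch z' c : ℤ) : ℂ) * (2 * Real.pi * Complex.I) := by
      rw [logAt_eq z hc, logAt_eq z' hc]; push_cast; ring
    rw [this]
    have h2 : (((branch z c - branch z' c : ℤ) : ℂ) * (2 * Real.pi * Complex.I)).im =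
        (branch z c - branch z' c : ℤ) * (2 * Real.pi) := by simp
    rw [h2, mul_div_cancel_right₀ _ (by positivity)]
  have hc : ContinuousAt (fun c => (logAt z c - logAt z' c).im / (2 * Real.pi)) w :=
    (Complex.continuous_im.continuousAt.comp
      ((continuousAt_logAt h).sub (continuousAt_logAt h'))).div_const _
  have h0 := ne_zero_of_mem_sector h
  filter_upwards [isOpen_ne.mem_nhds h0, hc.preimage_mem_nhds (Metric.ball_mem_nhds _ one_pos)]
    with c hc0 hc1
  change dist ((logAt z c - logAt z' c).im / (2 * Real.pi))
    ((logAt z w - logAt z' w).im / (2 * Real.pi)) < 1 at hc1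
  rw [← key hc0, ← key h0, Int.dist_cast_real, Int.dist_eq] at hc1
  have hc2 : |(branch z c - branch z' c) - (branch z w - branch z' w)| < 1 := by exact_mod_cast hc1
  rw [Int.abs_lt_one_iff, sub_eq_zero] at hc2
  exact hc2

/-! ### The gauge over the tubular neighbourhood -/

section gauge

variable {G : Type*} [Group G] {ι : Type*} (L : LocalSystem {x : S3 // x ∉ K} G ι)

/-- The gauge transformation that trivializes the local system along the new solid torus. -/
def gauge (x : S3) : G :=
  N.flat L.holonomy (Complex.arg (N.coords x).1, Complex.log (N.coords x).2)

/-- Over a sector, the gauge transformation becomes a flat section. -/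
theorem eventually_gauge (hl : N.longitudeHol L.holonomy = 1) {x : {x : S3 // x ∉ K}}
    {q : Circle × ℂ} (hq : N.toFun q = x) {z : Circle} (hz : q.2 ∈ sector z) {i : ι}
    (hi : x ∈ L.U i) :
    ∀ᶠ y in 𝓝 x, L.sec i y *
        (N.gauge L y * N.meridianHol L.holonomy ^ branch z (N.coords y).2) =
      L.sec i x * (N.gauge L x * N.meridianHol L.holonomy ^ branch z (N.coords x).2) := by
  -- This lift is continuous at `x`. It differs from the principal lift in `gauge` by a slide,
  -- harmless by `hl`, and by a shift, recorded by `branch`.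
  let lift : {x : S3 // x ∉ K} → ℝ × ℂ := fun y =>
    (Complex.arg q.1 + Complex.arg (((N.coords y).1 / q.1 : Circle) : ℂ),
      logAt z (N.coords y).2)
  have hc : ContinuousAt (fun y : {x : S3 // x ∉ K} => N.coords y) x := by
    refine ContinuousAt.comp (g := N.coords) ?_ continuous_subtype_val.continuousAt
    rw [← hq]
    exact N.continuousAt_coords q
  have hlift : ContinuousAt lift x := by
    refine (continuousAt_const.add ?_).prodMk ?_
    · refine ContinuousAt.comp (g := fun u : Circle => Complex.arg ((u / q.1 : Circle) : ℂ))
        (f := fun y : {x : S3 // x ∉ K} => (N.coords y).1) ?_ hc.fst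
      rw [← hq, N.coords_toFun]
      exact continuousAt_arg_div (mem_nearPoints_self _)
    · refine ContinuousAt.comp (g := logAt z)
        (f := fun y : {x : S3 // x ∉ K} => (N.coords y).2) ?_ hc.snd
      rw [← hq, N.coords_toFun]
      exact continuousAt_logAt hz
  have hcover (y : {x : S3 // x ∉ K}) (hy : (y : S3) ∈ range N.toFun) :
      N.cover (lift y) = y ∧ N.flat L.holonomy (lift y) =
        N.gauge L y * N.meridianHol L.holonomy ^ branch z (N.coords y).2 := by
    obtain ⟨y, hyK⟩ := y
    obtain ⟨⟨u, w⟩, rfl⟩ := hy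
    have hw : w ≠ 0 := fun h => hyK ((N.mem_iff _).2 h)
    have hu : Circle.exp (Complex.arg q.1 + Complex.arg ((u / q.1 : Circle) : ℂ)) = u := by
      rw [Circle.exp_add, Circle.exp_arg, Circle.exp_arg, mul_div_cancel]
    constructor
    · apply Subtype.ext
      change N.toFun (Circle.exp (_ + Complex.arg (((N.coords (N.toFun (u, w))).1 / q.1 : Circle)
        : ℂ)), Complex.exp (logAt z (N.coords (N.toFun (u, w))).2)) = _
      rw [N.coords_toFun, hu, exp_logAt z hw]
    · obtain ⟨n, hn⟩ : ∃ n : ℤ, Complex.arg q.1 + Complex.arg ((u / q.1 : Circle) : ℂ) =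
          Complex.arg u + n * (2 * Real.pi) :=
        Circle.exp_eq_exp.1 (hu.trans (Circle.exp_arg u).symm)
      have : lift ⟨N.toFun (u, w), hyK⟩ =
          slide n (shift (branch z w) (Complex.arg u, Complex.log w)) := by
        simp only [lift, N.coords_toFun, slide_apply, shift_apply, hn, logAt_eq z hw]
      rw [this, N.flat_slide _ hl, N.flat_shift, gauge, N.coords_toFun]
  have hx := hcover x ⟨q, hq⟩
  have hpar := (N.parallel_flat L).all N.cover.continuous (t := lift x) (j := i)
    (by rw [hx.1]; exact hi)
  have hrange : ∀ᶠ y : {x : S3 // x ∉ K} in 𝓝 x, (y : S3) ∈ range N.toFun :=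
    continuous_subtype_val.continuousAt.preimage_mem_nhds
      (N.isOpenEmbedding.isOpen_range.mem_nhds ⟨q, hq⟩)
  filter_upwards [hlift.eventually hpar, hrange] with y hy hyr
  rw [(hcover y hyr).1, (hcover y hyr).2, hx.1, hx.2] at hy
  exact hy

end gauge

/-! ### The topology of the surgered manifold -/

/-- The map from the exterior to the surgered manifold. -/
def toSurgery : C(N.Exterior, N.Surgery) where
  toFun x := Quot.mk _ (Sum.inl x)
  continuous_toFun := continuous_quot_mk.comp continuous_inl

/-- The map from the new solid torus to the surgered manifold. -/
def ofSolidTorus : C(SolidTorus, N.Surgery) where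
  toFun x := Quot.mk _ (Sum.inr x)
  continuous_toFun := continuous_quot_mk.comp continuous_inr

theorem surgery_cases {P : N.Surgery → Prop} (h1 : ∀ x, P (N.toSurgery x))
    (h2 : ∀ x, P (N.ofSolidTorus x)) (y : N.Surgery) : P y := by
  induction y using Quot.ind with | _ y => ?_
  rcases y with x | x
  · exact h1 x
  · exact h2 x

theorem isOpen_surgery {s : Set N.Surgery} :
    IsOpen s ↔ IsOpen (N.toSurgery ⁻¹' s) ∧ IsOpen (N.ofSolidTorus ⁻¹' s) :=
  (isQuotientMap_quot_mk (r := N.SurgeryGlue)).isOpen_preimage.symm.trans isOpen_sum_iff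

theorem boundary_eq (u w : Circle) :
    N.toSurgery (N.boundary (u, w)) =
      N.ofSolidTorus (⟨(u : ℂ), by simp [Circle.norm_coe]⟩, w) :=
  Quot.sound (SurgeryGlue.glue u w)

/-- Functions on the surgered manifold. -/
def surgeryLift {α : Sort*} (f : N.Exterior → α) (g : SolidTorus → α)
    (h : ∀ u w, f (N.boundary (u, w)) = g (⟨(u : ℂ), by simp [Circle.norm_coe]⟩, w)) :
    N.Surgery → α :=
  Quot.lift (Sum.elim f g) (by rintro _ _ ⟨u, w⟩; exact h u w)

/-- The points of the surgered manifold that are covered by the tubular neighbourhood and the new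
solid torus. -/
def core : Set N.Surgery :=
  {y | N.surgeryLift (fun x => (x : S3) ∈ range N.toFun) (fun _ => True)
    (fun u w => eq_true ⟨(u, w), rfl⟩) y}

/-- The coordinate on the core that is constant on the discs of the new solid torus. -/
def direction : N.Surgery → ℂ :=
  N.surgeryLift (fun x => (N.coords x).2) (fun x => (x.2 : ℂ))
    (fun u w => by
      change (N.coords (N.toFun (u, (w : ℂ)))).2 = w
      rw [N.coords_toFun])

/-- Away from the boundary torus nothing is glued, so the map to the surgered manifold is open
there. -/
theorem eventually_toSurgery {x : N.Exterior} (hx : (x : S3) ∉ N.closedSolidTorus)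
    {P : N.Surgery → Prop} (h : ∀ᶠ y in 𝓝 x, P (N.toSurgery y)) :
    ∀ᶠ y in 𝓝 (N.toSurgery x), P y := by
  obtain ⟨O, hO, ho, hxO⟩ := eventually_nhds_iff.1 h
  let s : Set N.Surgery :=
    {y | N.surgeryLift (fun x => (x : S3) ∉ N.closedSolidTorus ∧ x ∈ O) (fun _ => False)
      (fun u w => eq_false (fun h => h.1 ⟨(u, w), by simp [Circle.norm_coe], rfl⟩)) y}
  have hs : IsOpen s := by
    refine N.isOpen_surgery.2 ⟨?_, isOpen_empty⟩
    exact (N.isClosed_closedSolidTorus.isOpen_compl.preimage continuous_subtype_val).inter ho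
  filter_upwards [hs.mem_nhds (show N.toSurgery x ∈ s from ⟨hx, hxO⟩)] with y hy
  revert hy
  refine N.surgery_cases (P := fun y => y ∈ s → P y) (fun x hx => hO x hx.2) (fun x hx => ?_) y
  exact hx.elim

theorem isOpen_direction {O : Set ℂ} (hO : IsOpen O) : IsOpen (N.core ∩ N.direction ⁻¹' O) := by
  refine N.isOpen_surgery.2 ⟨?_, ?_⟩
  · have h : IsOpen (N.toFun '' {q | q.2 ∈ O}) :=
      N.isOpenEmbedding.isOpenMap _ (hO.preimage continuous_snd)
    convert h.preimage (continuous_subtype_val (p := fun x => x ∉ N.openSolidTorus)) using 1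
    ext x
    constructor
    · rintro ⟨⟨q, hq⟩, hx⟩
      refine ⟨q, ?_, hq⟩
      change (N.coords x).2 ∈ O at hx
      rw [← hq, N.coords_toFun] at hx
      exact hx
    · rintro ⟨q, hqO, hq⟩
      refine ⟨⟨q, hq⟩, ?_⟩
      change (N.coords x).2 ∈ O
      rw [← hq, N.coords_toFun]
      exact hqO
  · have : IsOpen {x : SolidTorus | (x.2 : ℂ) ∈ O} := hO.preimage (by fun_prop)
    convert this using 1
    ext x
    exact ⟨fun h => h.2, fun h => ⟨trivial, h⟩⟩

theorem eventually_direction {y : N.Surgery} (hy : y ∈ N.core) {P : ℂ → Prop}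
    (h : ∀ᶠ c in 𝓝 (N.direction y), P c) : ∀ᶠ y' in 𝓝 y, P (N.direction y') := by
  obtain ⟨O, hO, ho, hyO⟩ := eventually_nhds_iff.1 h
  filter_upwards [(N.isOpen_direction ho).mem_nhds ⟨hy, hyO⟩] with y' hy'
  exact hO _ hy'.2

/-! ### The local system on the surgered manifold -/

section system

variable {G : Type*} [Group G] {ι : Type*} (L : LocalSystem {x : S3 // x ∉ K} G ι)

/-- The domains of the charts of the extended local system. -/
def surgeryDom : ι ⊕ Circle → Set N.Surgery
  | .inl i => {y | N.surgeryLift (fun x => (x : S3) ∉ N.closedSolidTorus ∧ N.incl x ∈ L.U i)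
      (fun _ => False)
      (fun u w => eq_false (fun h => h.1 ⟨(u, w), by simp [Circle.norm_coe], rfl⟩)) y}
  | .inr z => N.core ∩ N.direction ⁻¹' sector z

open Classical in
/-- The flat sections of the extended local system. -/
def surgerySec : ι ⊕ Circle → N.Surgery → G
  | .inl i => N.surgeryLift
      -- The value 1 on the torus only serves compatibility with the gluing; the chart excludes
      -- these points.
      (fun x => if (x : S3) ∈ N.closedSolidTorus then 1 else L.sec i (N.incl x) * N.gauge L x)
      (fun _ => 1) (fun u w => if_pos ⟨(u, w), by simp [Circle.norm_coe], rfl⟩)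
  -- This depends on the direction alone, so it is constant along the discs and makes sense on the
  -- whole new solid torus.
  | .inr z => fun y => N.meridianHol L.holonomy ^ (-branch z (N.direction y))

theorem surgerySec_inl {x : N.Exterior} (hx : (x : S3) ∉ N.closedSolidTorus) (i : ι) :
    N.surgerySec L (.inl i) (N.toSurgery x) = L.sec i (N.incl x) * N.gauge L x := if_neg hx

theorem exists_sector {x : N.Exterior} (hx : (x : S3) ∈ N.closedSolidTorus) :
    ∃ z : Circle, N.toSurgery x ∈ N.surgeryDom L (.inr z) := by
  obtain ⟨⟨u, w⟩, hw, he⟩ := hx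
  have hw1 : ‖w‖ = 1 := by
    refine le_antisymm hw (not_lt.1 fun h => x.2 ⟨(u, w), h, he⟩)
  refine ⟨⟨w, by simp [Submonoid.unitSphere, hw1]⟩, ⟨(u, w), he⟩, ?_⟩
  change (N.coords x).2 ∈ sector _
  rw [← he, N.coords_toFun]
  exact mem_sector_self ⟨w, _⟩

theorem exists_surgeryDom (y : N.Surgery) : ∃ i, y ∈ N.surgeryDom L i := by
  refine N.surgery_cases (P := fun y => ∃ i, y ∈ N.surgeryDom L i) (fun x => ?_) (fun x => ?_) y
  · by_cases hx : (x : S3) ∈ N.closedSolidTorus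
    · obtain ⟨z, hz⟩ := N.exists_sector L hx
      exact ⟨_, hz⟩
    · exact ⟨.inl (L.idx (N.incl x)), hx, L.mem_idx _⟩
  · exact ⟨.inr x.2, trivial, mem_sector_self x.2⟩

/-- Compatibility is stated on the exterior including its boundary, where no `inl` chart reaches;
`hol_surgerySystem` needs this for paths that touch the torus. -/
theorem eventually_surgerySec (hl : N.longitudeHol L.holonomy = 1) {x : N.Exterior} {i : ι}
    {z : Circle} (hi : N.incl x ∈ L.U i) (hz : N.toSurgery x ∈ N.surgeryDom L (.inr z)) :
    ∀ᶠ y in 𝓝 x, (L.sec i (N.incl y) * N.gauge L y) *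
        (N.surgerySec L (.inr z) (N.toSurgery y))⁻¹ =
      (L.sec i (N.incl x) * N.gauge L x) * (N.surgerySec L (.inr z) (N.toSurgery x))⁻¹ := by
  obtain ⟨⟨q, hq⟩, hqz⟩ := hz
  change (N.coords x).2 ∈ sector z at hqz
  rw [← hq, N.coords_toFun] at hqz
  filter_upwards [N.incl.continuous.continuousAt.eventually
    (N.eventually_gauge L hl (x := N.incl x) hq hqz hi)] with y hy
  have e (y : N.Exterior) : (N.surgerySec L (.inr z) (N.toSurgery y))⁻¹ =
      N.meridianHol L.holonomy ^ branch z (N.coords y).2 := by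
    change (N.meridianHol L.holonomy ^ (-branch z (N.coords y).2))⁻¹ = _
    rw [zpow_neg, inv_inv]
  rw [e, e, mul_assoc, mul_assoc]
  exact hy

theorem eventually_surgerySec_inv (hl : N.longitudeHol L.holonomy = 1) {x : N.Exterior} {i : ι}
    {z : Circle} (hx : (x : S3) ∉ N.closedSolidTorus)
    (hi : N.incl x ∈ L.U i) (hz : N.toSurgery x ∈ N.surgeryDom L (.inr z)) :
    ∀ᶠ y in 𝓝 (N.toSurgery x), N.surgerySec L (.inl i) y * (N.surgerySec L (.inr z) y)⁻¹ =
      N.surgerySec L (.inl i) (N.toSurgery x) *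
        (N.surgerySec L (.inr z) (N.toSurgery x))⁻¹ := by
  refine N.eventually_toSurgery hx ?_
  have hopen : ∀ᶠ y : N.Exterior in 𝓝 x, (y : S3) ∉ N.closedSolidTorus :=
    continuous_subtype_val.continuousAt.preimage_mem_nhds
      (N.isClosed_closedSolidTorus.isOpen_compl.mem_nhds hx)
  filter_upwards [hopen, N.eventually_surgerySec L hl hi hz] with y hy hy2
  rw [N.surgerySec_inl L hy, N.surgerySec_inl L hx]
  exact hy2

/-- The extension of a local system with trivial holonomy along the parallel to the surgered
manifold. -/
def surgerySystem (hl : N.longitudeHol L.holonomy = 1) :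
    LocalSystem N.Surgery G (ι ⊕ Circle) where
  U := N.surgeryDom L
  isOpen_U
    | .inl i => N.isOpen_surgery.2
        ⟨(N.isClosed_closedSolidTorus.isOpen_compl.preimage continuous_subtype_val).inter
          ((L.isOpen_U i).preimage N.incl.continuous), isOpen_empty⟩
    | .inr z => N.isOpen_direction (isOpen_sector z)
  idx y := (N.exists_surgeryDom L y).choose
  mem_idx y := (N.exists_surgeryDom L y).choose_spec
  sec := N.surgerySec L
  locConst i j y hi hj := by
    have symm {u v w z : G} (h : u * v⁻¹ = w * z⁻¹) : v * u⁻¹ = z * w⁻¹ := by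
      rw [← inv_inj, mul_inv_rev, mul_inv_rev, inv_inv, inv_inv, h]
    rcases i with i | z <;> rcases j with j | z'
    · induction y using N.surgery_cases with
      | h2 x => exact hi.elim
      | h1 x => ?_
      refine N.eventually_toSurgery hi.1 ?_
      have hopen : ∀ᶠ y : N.Exterior in 𝓝 x, (y : S3) ∉ N.closedSolidTorus :=
        continuous_subtype_val.continuousAt.preimage_mem_nhds
          (N.isClosed_closedSolidTorus.isOpen_compl.mem_nhds hi.1)
      filter_upwards [hopen, N.incl.continuous.continuousAt.eventually
        (L.locConst i j _ hi.2 hj.2)] with y hy hy2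
      rw [N.surgerySec_inl L hy, N.surgerySec_inl L hi.1, N.surgerySec_inl L hy,
        N.surgerySec_inl L hi.1]
      simpa using hy2
    · induction y using N.surgery_cases with
      | h2 x => exact hi.elim
      | h1 x => ?_
      exact (N.eventually_surgerySec_inv L hl hi.1 hi.2 hj).mono fun y => symm
    · induction y using N.surgery_cases with
      | h2 x => exact hj.elim
      | h1 x => ?_
      exact N.eventually_surgerySec_inv L hl hj.1 hj.2 hi
    · filter_upwards [N.eventually_direction hi.1 (eventually_branch_sub hi.2 hj.2)] with y' hy'
      change _ ^ (-branch z' _) * (_ ^ (-branch z _))⁻¹ =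
        _ ^ (-branch z' _) * (_ ^ (-branch z _))⁻¹
      rw [← zpow_neg, ← zpow_neg, ← zpow_add, ← zpow_add, neg_neg, neg_neg, neg_add_eq_sub,
        neg_add_eq_sub, hy']

/-- The holonomy on the surgered manifold is conjugate to the holonomy on the exterior. -/
theorem hol_surgerySystem (hl : N.longitudeHol L.holonomy = 1) {x y : N.Exterior}
    (p : Path x y) :
    (N.surgerySystem L hl).holonomy.hol (p.map N.toSurgery.continuous) =
      (N.gauge L y)⁻¹ * L.holonomy.hol (p.map N.incl.continuous) * N.gauge L x := by
  obtain ⟨v, hv, hpv⟩ := L.exists_parallel_hol (p.map N.incl.continuous)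
  -- The sections were multiplied by the gauge on the right, so parallel functions acquire its
  -- inverse on the left.
  have hpar : (N.surgerySystem L hl).Parallel (p.map N.toSurgery.continuous)
      (fun t => (N.gauge L (p t))⁻¹ * v t) := by
    intro t
    by_cases ht : (p t : S3) ∈ N.closedSolidTorus
    · obtain ⟨z, hz⟩ := N.exists_sector L ht
      refine ⟨.inr z, hz, ?_⟩
      have hi := L.mem_idx (N.incl (p t))
      filter_upwards [p.continuous.continuousAt.eventually (N.eventually_surgerySec L hl hi hz),
        hv.all (p.map N.incl.continuous).continuous hi] with s h1 h2
      change N.surgerySec L (.inr z) (N.toSurgery (p s)) * _ =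
        N.surgerySec L (.inr z) (N.toSurgery (p t)) * _
      have e (s : I) : N.surgerySec L (.inr z) (N.toSurgery (p s)) *
          ((N.gauge L (p s))⁻¹ * v s) =
          ((L.sec (L.idx (N.incl (p t))) (N.incl (p s)) * N.gauge L (p s)) *
            (N.surgerySec L (.inr z) (N.toSurgery (p s)))⁻¹)⁻¹ *
            (L.sec (L.idx (N.incl (p t))) (N.incl (p s)) * v s) := by group
      rw [e, e, h1]
      congr 1
    · refine ⟨.inl (L.idx (N.incl (p t))), ⟨ht, L.mem_idx _⟩, ?_⟩
      have hopen : ∀ᶠ s in 𝓝 t, (p s : S3) ∉ N.closedSolidTorus :=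
        (continuous_subtype_val.comp p.continuous).continuousAt.preimage_mem_nhds
          (N.isClosed_closedSolidTorus.isOpen_compl.mem_nhds ht)
      filter_upwards [hopen, hv.all (p.map N.incl.continuous).continuous (t := t)
        (L.mem_idx (N.incl (p t)))] with s h1 h2
      change N.surgerySec L (.inl (L.idx (N.incl (p t)))) (N.toSurgery (p s)) *
          ((N.gauge L (p s))⁻¹ * v s) =
        N.surgerySec L (.inl (L.idx (N.incl (p t)))) (N.toSurgery (p t)) *
          ((N.gauge L (p t))⁻¹ * v t)
      rw [N.surgerySec_inl L h1, N.surgerySec_inl L ht, mul_assoc, mul_assoc,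
        mul_inv_cancel_left, mul_inv_cancel_left]
      exact h2
  rw [(N.surgerySystem L hl).hol_eq_of_parallel _ hpar, hpv]
  simp [mul_assoc]

end system

theorem joined_ofSolidTorus (x : SolidTorus) :
    Joined (N.toSurgery (N.boundary (1, x.2))) (N.ofSolidTorus x) := by
  rw [N.boundary_eq]
  have hp : IsPathConnected (Metric.closedBall (0 : ℂ) 1) :=
    (convex_closedBall 0 1).isPathConnected ⟨0, by simp⟩
  have := isPathConnected_iff_pathConnectedSpace.1 hp
  obtain ⟨γ⟩ := PathConnectedSpace.joined
    (⟨((1 : Circle) : ℂ), by simp⟩ : Metric.closedBall (0 : ℂ) 1) x.1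
  exact ⟨(γ.prod (Path.refl x.2)).map N.ofSolidTorus.continuous⟩

theorem joined_surgery [PathConnectedSpace N.Exterior] (e : N.Exterior) (y : N.Surgery) :
    Joined (N.toSurgery e) y := by
  have h (x : N.Exterior) : Joined (N.toSurgery e) (N.toSurgery x) := by
    obtain ⟨γ⟩ := PathConnectedSpace.joined e x
    exact ⟨γ.map N.toSurgery.continuous⟩
  exact N.surgery_cases h (fun x => (h _).trans (N.joined_ofSolidTorus x)) y

end TubularNbhd

/-! ### Homomorphisms on the knot group and on the group of the surgery -/

namespace TubularNbhd

variable (N : TubularNbhd figureEightKnot) {G : Type} [Group G] (a b : G)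
  (hR : b⁻¹ * a⁻¹ * b * a⁻¹ * b⁻¹ * a * b * a⁻¹ * b * a = 1)

/-- The homomorphism on the knot group that is given by a pair of elements which satisfy the
relation of the figure-eight knot. -/
def repr : N.knotGroup →* G := ((knotSystem a b hR).holonomy.comap N.incl).toHom N.basePoint

theorem repr_meridian : N.repr a b hR N.meridian = N.meridianHol (knotSystem a b hR).holonomy := by
  rw [← hol_meridianLoop]
  exact Holonomy.toHom_mk _ _

theorem repr_longitude :
    N.repr a b hR N.longitude = N.longitudeHol (knotSystem a b hR).holonomy := by
  rw [← hol_longitudeLoop]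
  exact Holonomy.toHom_mk _ _

/-- Up to a common conjugation, every label of the diagram is the holonomy along a loop. -/
theorem exists_conj_hol : ∃ k : G, ∀ i j : ℤ, ∃ p : Path N.basePoint N.basePoint,
    (knotSystem a b hR).holonomy.hol (p.map N.incl.continuous) =
      k * cellLabel a b i j * k⁻¹ := by
  obtain ⟨s⟩ := PathConnectedSpace.joined
    (⟨farPoint 2, notMem_of_notMem_knotBox (farPoint_notMem 2)⟩ : KnotCompl) (N.incl N.basePoint)
  refine ⟨(knotSystem a b hR).holonomy.hol s, fun i j => ?_⟩
  obtain ⟨p, hp⟩ := exists_loop a b hR i j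
  obtain ⟨q, hq⟩ := N.exists_path_exterior (s.symm.trans (p.symm.trans s))
  refine ⟨q, ?_⟩
  rw [← (knotSystem a b hR).holonomy.hol_congr hq]
  simp only [Holonomy.hol_trans, Holonomy.hol_symm, hp, inv_inv]

theorem exists_repr : ∃ k : G, (∃ x, N.repr a b hR x = k * a * k⁻¹) ∧
    ∃ x, N.repr a b hR x = k * b * k⁻¹ := by
  obtain ⟨k, hk⟩ := N.exists_conj_hol a b hR
  -- The cells (0, 0) and (1, 4) carry the labels `a` and `b`.
  obtain ⟨p, hp⟩ := hk 0 0
  obtain ⟨q, hq⟩ := hk 1 4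
  exact ⟨k, ⟨_, (Holonomy.toHom_mk _ p).trans hp⟩, ⟨_, (Holonomy.toHom_mk _ q).trans hq⟩⟩

/-- If the longitude acts trivially, the homomorphism descends to the surgered manifold. -/
theorem exists_repr_surgery (hl : N.repr a b hR N.longitude = 1) (x : N.Surgery) :
    ∃ (ψ : FundamentalGroup N.Surgery x →* G) (k : G),
      (∃ y, ψ y = k * a * k⁻¹) ∧ ∃ y, ψ y = k * b * k⁻¹ := by
  rw [repr_longitude] at hl
  let L := knotSystem a b hR
  let H := (N.surgerySystem L hl).holonomy
  obtain ⟨k, hk⟩ := N.exists_conj_hol a b hR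
  obtain ⟨r⟩ := N.joined_surgery N.basePoint x
  have key (i j : ℤ) : ∃ y, H.toHom x y =
      (H.hol r * (N.gauge L N.basePoint)⁻¹ * k) * cellLabel a b i j *
        (H.hol r * (N.gauge L N.basePoint)⁻¹ * k)⁻¹ := by
    obtain ⟨p, hp⟩ := hk i j
    refine ⟨_, (Holonomy.toHom_mk _
      (r.symm.trans ((p.map N.toSurgery.continuous).trans r))).trans ?_⟩
    rw [Holonomy.hol_trans, Holonomy.hol_trans, Holonomy.hol_symm, N.hol_surgerySystem L hl, hp]
    group
  exact ⟨H.toHom x, _, key 0 0, key 1 4⟩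

end TubularNbhd

open Matrix

/-! ### Binary dihedral representation -/

/-- The quotient of the binary dihedral group of order 20 by its commutator subgroup. -/
def quaternionChar : QuaternionGroup 5 →* Multiplicative (ZMod 4) where
  toFun
    | .a i => .ofAdd (2 * (i.val : ZMod 4))
    | .xa i => .ofAdd (1 + 2 * (i.val : ZMod 4))
  map_one' := rfl
  map_mul' := by decide +kernel

theorem stdAddChar_five : ZMod.stdAddChar (N := 2 * 5) 5 = -1 := by
  have h : ZMod.stdAddChar (N := 2 * 5) 5 * ZMod.stdAddChar (N := 2 * 5) 5 = 1 := by
    rw [← AddChar.map_add_eq_mul, show (5 + 5 : ZMod (2 * 5)) = 0 from rfl, AddChar.map_zero_eq_one]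
  refine (mul_self_eq_one_iff.1 h).resolve_left fun h1 => ?_
  rw [← AddChar.map_zero_eq_one (ZMod.stdAddChar (N := 2 * 5))] at h1
  exact absurd (ZMod.injective_stdAddChar h1) (by decide)

/-- The embedding of the binary dihedral group of order 20 into `SL₂(ℂ)`. -/
def quaternionRep : QuaternionGroup 5 →* SpecialLinearGroup (Fin 2) ℂ where
  toFun
    | .a i => ⟨!![ZMod.stdAddChar i, 0; 0, ZMod.stdAddChar (-i)], by
        rw [det_fin_two_of, ← AddChar.map_add_eq_mul]; simp⟩
    | .xa i => ⟨!![0, -ZMod.stdAddChar (-i); ZMod.stdAddChar i, 0], by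
        rw [det_fin_two_of, neg_mul, ← AddChar.map_add_eq_mul]; simp⟩
  map_one' := by
    apply Subtype.ext
    change !![ZMod.stdAddChar (0 : ZMod (2 * 5)), 0; 0, ZMod.stdAddChar (-(0 : ZMod (2 * 5)))] =
      (1 : Matrix (Fin 2) (Fin 2) ℂ)
    simp [one_fin_two]
  map_mul' := by
    rintro (i | i) (j | j) <;> apply Subtype.ext
    · change !![ZMod.stdAddChar (i + j), 0; 0, ZMod.stdAddChar (-(i + j))] =
        !![ZMod.stdAddChar i, 0; 0, ZMod.stdAddChar (-i)] *
          !![ZMod.stdAddChar j, 0; 0, ZMod.stdAddChar (-j)]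
      simp [← AddChar.map_add_eq_mul, add_comm]
    · change !![0, -ZMod.stdAddChar (-(j - i)); ZMod.stdAddChar (j - i), 0] =
        !![ZMod.stdAddChar i, 0; 0, ZMod.stdAddChar (-i)] *
          !![0, -ZMod.stdAddChar (-j); ZMod.stdAddChar j, 0]
      simp [← AddChar.map_add_eq_mul, sub_eq_add_neg, add_comm]
    · change !![0, -ZMod.stdAddChar (-(i + j)); ZMod.stdAddChar (i + j), 0] =
        !![0, -ZMod.stdAddChar (-i); ZMod.stdAddChar i, 0] *
          !![ZMod.stdAddChar j, 0; 0, ZMod.stdAddChar (-j)]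
      simp [← AddChar.map_add_eq_mul, add_comm]
    · change !![ZMod.stdAddChar (((5 : ℕ) : ZMod (2 * 5)) + j - i), 0; 0,
          ZMod.stdAddChar (-(((5 : ℕ) : ZMod (2 * 5)) + j - i))] =
        !![0, -ZMod.stdAddChar (-i); ZMod.stdAddChar i, 0] *
          !![0, -ZMod.stdAddChar (-j); ZMod.stdAddChar j, 0]
      have h5 : -((5 : ℕ) : ZMod (2 * 5)) = 5 := rfl
      have h6 : ((5 : ℕ) : ZMod (2 * 5)) = 5 := rfl
      have e1 : ((5 : ℕ) : ZMod (2 * 5)) + j - i = 5 + (-i + j) := by rw [h6]; ring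
      have e2 : -(((5 : ℕ) : ZMod (2 * 5)) + j - i) = 5 + (i + -j) := by
        rw [neg_sub, sub_add_eq_sub_sub, sub_eq_add_neg i, h5]; ring
      rw [e2, e1]
      have h (c : ℂ) : ZMod.stdAddChar (5 : ZMod (2 * 5)) * c = -c :=
        (congrArg (· * c) stdAddChar_five).trans (neg_one_mul c)
      simp only [AddChar.map_add_eq_mul, h]
      simp

theorem quaternion_relation : (.xa 2 : QuaternionGroup 5)⁻¹ * (.xa 0)⁻¹ * .xa 2 * (.xa 0)⁻¹ *
    (.xa 2)⁻¹ * .xa 0 * .xa 2 * (.xa 0)⁻¹ * .xa 2 * .xa 0 = 1 := by decide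

/-- A homomorphism to `SL₂` whose image contains two elements without common eigenvector is
irreducible. -/
theorem isIrreducible_linearRep {G : Type*} [Group G] (ρ : G →* SpecialLinearGroup (Fin 2) ℂ)
    (x y : G) (h : ∀ (v : Fin 2 → ℂ) (c d : ℂ), (ρ x : Matrix (Fin 2) (Fin 2) ℂ) *ᵥ v = c • v →
      (ρ y : Matrix (Fin 2) (Fin 2) ℂ) *ᵥ v = d • v → v = 0) :
    (linearRep ρ).IsIrreducible := by
  have hbt : (⊥ : Subrepresentation (linearRep ρ)) ≠ ⊤ := fun e =>
    bot_ne_top (α := Submodule ℂ (Fin 2 → ℂ)) (congrArg Subrepresentation.toSubmodule e)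
  have : Nontrivial (Subrepresentation (linearRep ρ)) := ⟨_, _, hbt⟩
  refine { eq_bot_or_eq_top := fun W => ?_ }
  by_cases hW : W.toSubmodule = ⊥
  · exact .inl (Subrepresentation.toSubmodule_injective hW)
  refine .inr (Subrepresentation.toSubmodule_injective ?_)
  by_contra hT
  obtain ⟨v, hv, hv0⟩ := Submodule.exists_mem_ne_zero_of_ne_bot hW
  have hf : Module.finrank ℂ W.toSubmodule ≤ 1 := by
    have := Submodule.finrank_lt hT
    rw [Module.finrank_fin_fun] at this
    omega
  have key (g : G) : ∃ c : ℂ, (ρ g : Matrix (Fin 2) (Fin 2) ℂ) *ᵥ v = c • v := by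
    have hg : (ρ g : Matrix (Fin 2) (Fin 2) ℂ) *ᵥ v ∈ W.toSubmodule :=
      W.apply_mem_toSubmodule g hv
    have hf1 : Module.finrank ℂ W.toSubmodule = 1 :=
      le_antisymm hf (Submodule.one_le_finrank_iff.2 hW)
    obtain ⟨c, hc⟩ := exists_smul_eq_of_finrank_eq_one hf1
      (x := (⟨v, hv⟩ : W.toSubmodule)) (fun e => hv0 (congrArg Subtype.val e)) ⟨_, hg⟩
    exact ⟨c, (congrArg Subtype.val hc).symm⟩
  obtain ⟨c, hc⟩ := key x
  obtain ⟨d, hd⟩ := key y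
  exact hv0 (h v c d hc hd)

/-- An antidiagonal matrix determines the squared slope of its eigenvectors; for different values of
`i + i` there is no common one. -/
theorem quaternionRep_eigenvector {i : ZMod (2 * 5)} {v : Fin 2 → ℂ} {c : ℂ}
    (h : (quaternionRep (.xa i) : Matrix (Fin 2) (Fin 2) ℂ) *ᵥ v = c • v) :
    ZMod.stdAddChar (i + i) * v 0 ^ 2 = - v 1 ^ 2 := by
  change !![0, -ZMod.stdAddChar (-i); ZMod.stdAddChar i, 0] *ᵥ v = c • v at h
  have h0 : -ZMod.stdAddChar (-i) * v 1 = c * v 0 := by simpa [vecHead, vecTail] using congrFun h 0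
  have h1 : ZMod.stdAddChar i * v 0 = c * v 1 := by simpa [vecHead, vecTail] using congrFun h 1
  have h2 : ZMod.stdAddChar i * ZMod.stdAddChar (-i) = (1 : ℂ) := by
    rw [← AddChar.map_add_eq_mul]; simp
  rw [AddChar.map_add_eq_mul]
  linear_combination (ZMod.stdAddChar i * v 0) * h1 - ZMod.stdAddChar i * v 1 * h0 -
    v 1 ^ 2 * h2

/-! ### Triangular representation -/

/-- The upper triangular matrices of determinant `1`, in terms of their first row. -/
@[ext]
structure Triangular where
  diag : ℂˣ
  off : ℂ

namespace Triangular

instance : Mul Triangular := ⟨fun g h => ⟨g.diag * h.diag, g.diag * h.off + g.off * (h.diag⁻¹ : ℂˣ)⟩⟩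

instance : One Triangular := ⟨⟨1, 0⟩⟩

instance : Inv Triangular := ⟨fun g => ⟨g.diag⁻¹, -g.off⟩⟩

@[simp] theorem mul_diag (g h : Triangular) : (g * h).diag = g.diag * h.diag := rfl

@[simp] theorem mul_off (g h : Triangular) :
    (g * h).off = g.diag * h.off + g.off * (h.diag⁻¹ : ℂˣ) := rfl

@[simp] theorem one_diag : (1 : Triangular).diag = 1 := rfl

@[simp] theorem one_off : (1 : Triangular).off = 0 := rfl

@[simp] theorem inv_diag (g : Triangular) : g⁻¹.diag = g.diag⁻¹ := rfl

@[simp] theorem inv_off (g : Triangular) : g⁻¹.off = -g.off := rfl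

instance : Group Triangular :=
  Group.ofLeftAxioms
    (fun g h k => by ext <;> simp [mul_assoc]; ring)
    (fun g => by ext <;> simp)
    (fun g => by ext <;> simp; ring)

/-- The upper left entry. -/
def character : Triangular →* ℂˣ where
  toFun := diag
  map_one' := rfl
  map_mul' _ _ := rfl

/-- The matrix of an element. -/
def toSL : Triangular →* SpecialLinearGroup (Fin 2) ℂ where
  toFun g := ⟨!![(g.diag : ℂ), g.off; 0, (g.diag⁻¹ : ℂˣ)], by simp [det_fin_two_of]⟩
  map_one' := by apply Subtype.ext; simp [one_fin_two]
  map_mul' g h := by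
    apply Subtype.ext
    change !![((g.diag * h.diag : ℂˣ) : ℂ), g.diag * h.off + g.off * (h.diag⁻¹ : ℂˣ); 0,
        ((g.diag * h.diag)⁻¹ : ℂˣ)] =
      !![(g.diag : ℂ), g.off; 0, (g.diag⁻¹ : ℂˣ)] * !![(h.diag : ℂ), h.off; 0, (h.diag⁻¹ : ℂˣ)]
    simp [mul_comm]

theorem toSL_injective : Function.Injective toSL := by
  intro g h e
  have e' := congrArg Subtype.val e
  have h0 : (g.diag : ℂ) = h.diag := congrFun (congrFun e' 0) 0
  have h1 : g.off = h.off := congrFun (congrFun e' 0) 1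
  exact Triangular.ext (Units.ext h0) h1

theorem trace_toSL (g : Triangular) :
    trace (toSL g : Matrix (Fin 2) (Fin 2) ℂ) = g.diag + (g.diag⁻¹ : ℂˣ) := by
  change trace !![(g.diag : ℂ), g.off; 0, (g.diag⁻¹ : ℂˣ)] = _
  simp [trace_fin_two]

/-- The golden ratio as a complex unit. -/
def golden : ℂˣ := Units.mk0 (Real.goldenRatio : ℂ) (by exact_mod_cast Real.goldenRatio_ne_zero)

theorem golden_sq : (golden : ℂ) ^ 2 = golden + 1 := by
  change (Real.goldenRatio : ℂ) ^ 2 = Real.goldenRatio + 1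
  exact_mod_cast Real.goldenRatio_sq

theorem golden_add_inv : (golden : ℂ) + (golden⁻¹ : ℂˣ) = ((Real.sqrt 5 : ℝ) : ℂ) := by
  rw [Units.val_inv_eq_inv_val]
  change (Real.goldenRatio : ℂ) + (Real.goldenRatio : ℂ)⁻¹ = _
  rw [← Real.goldenRatio_sub_goldenConj, ← Complex.ofReal_inv, Real.inv_goldenRatio]
  push_cast; ring

theorem golden_pow_ne_one {n : ℕ} (hn : n ≠ 0) : golden ^ n ≠ 1 := by
  intro h
  have h1 : (Real.goldenRatio : ℂ) ^ n = 1 := by simpa [golden] using congrArg Units.val h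
  have h2 : Real.goldenRatio ^ n = 1 := by exact_mod_cast h1
  exact (one_lt_pow₀ Real.one_lt_goldenRatio hn).ne' h2

theorem not_isOfFinOrder_golden : ¬ IsOfFinOrder golden := by
  rw [isOfFinOrder_iff_pow_eq_one]
  rintro ⟨n, hn, h⟩
  exact golden_pow_ne_one hn.ne' h

/-- The diagonal entry is 1 since the exponent sum of `golden` is zero; the corner entry vanishes by
φ² = φ + 1. -/
theorem relation : (⟨golden, 1⟩ : Triangular)⁻¹ * ⟨golden, 0⟩⁻¹ * ⟨golden, 1⟩ * ⟨golden, 0⟩⁻¹ *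
    ⟨golden, 1⟩⁻¹ * ⟨golden, 0⟩ * ⟨golden, 1⟩ * ⟨golden, 0⟩⁻¹ * ⟨golden, 1⟩ * ⟨golden, 0⟩ = 1 := by
  ext
  · simp
  · have h := golden_sq
    have h0 := golden.ne_zero
    simp
    field_simp
    grind

end Triangular

namespace TubularNbhd

/-! ### The representations of the figure-eight knot group -/

theorem IsZeroFramed.map_longitude {K : Set S3} {N : TubularNbhd K} (hN : N.IsZeroFramed)
    {A : Type*} [CommGroup A] (χ : N.knotGroup →* A) : χ N.longitude = 1 := by
  rw [← Abelianization.lift_apply_of χ, hN, map_one]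

/-- A pair of elements which satisfy the relation of the figure-eight knot defines a homomorphism
on the knot group, which descends to the surgered manifold if it is trivial on the parallel. -/
theorem exists_hom (N : TubularNbhd figureEightKnot) {G : Type} [Group G] (a b : G)
    (hR : b⁻¹ * a⁻¹ * b * a⁻¹ * b⁻¹ * a * b * a⁻¹ * b * a = 1) :
    ∃ ρ : N.knotGroup →* G, Commute (ρ N.longitude) (ρ N.meridian) ∧
      -- Both signs must be allowed, as the orientation of the parametrization is arbitrary.
      (IsConj a (ρ N.meridian) ∨ IsConj a⁻¹ (ρ N.meridian)) ∧
      (∃ k x y, ρ x = k * a * k⁻¹ ∧ ρ y = k * b * k⁻¹) ∧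
      (ρ N.longitude = 1 → ∀ x : N.Surgery, ∃ (ψ : FundamentalGroup N.Surgery x →* G), ∃ k y z,
        ψ y = k * a * k⁻¹ ∧ ψ z = k * b * k⁻¹) := by
  refine ⟨N.repr a b hR, ?_, ?_, ?_, fun hl x => ?_⟩
  · rw [repr_longitude, repr_meridian]
    exact N.commute_longitudeHol_meridianHol _
  · rw [repr_meridian]
    obtain ⟨n, rfl | rfl, hn⟩ := isConj_meridianHol N a b hR
    · exact .inl (zpow_one a ▸ hn).symm
    · exact .inr (zpow_neg_one a ▸ hn).symm
  · obtain ⟨k, ⟨x, hx⟩, ⟨y, hy⟩⟩ := N.exists_repr a b hR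
    exact ⟨k, x, y, hx, hy⟩
  · obtain ⟨ψ, k, ⟨y, hy⟩, ⟨z, hz⟩⟩ := N.exists_repr_surgery a b hR hl x
    exact ⟨ψ, k, y, z, hy, hz⟩

end TubularNbhd

/-! ### Binary dihedral case: meridian, longitude, irreducibility -/

theorem quaternion_of_isConj {m : QuaternionGroup 5}
    (hm : IsConj (.xa 0) m ∨ IsConj (.xa 0)⁻¹ m) : ∃ i, m = .xa i := by
  have h : ∀ g : QuaternionGroup 5, (∃ i, g * .xa 0 * g⁻¹ = .xa i) ∧
      ∃ i, g * (.xa 0)⁻¹ * g⁻¹ = .xa i := by decide +kernel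
  rcases hm with hm | hm
  · obtain ⟨g, rfl⟩ := isConj_iff.1 hm
    exact (h g).1
  · obtain ⟨g, rfl⟩ := isConj_iff.1 hm
    exact (h g).2

/-- The kernel of `quaternionChar` is cyclic of order 5 and conjugation by `xa i` inverts it; in odd
order, inversion fixes only the identity. -/
theorem quaternion_eq_one : ∀ (g : QuaternionGroup 5) (i), quaternionChar g = 1 →
    Commute g (.xa i) → g = 1 := by
  have h : ∀ (g : QuaternionGroup 5) (i), quaternionChar g = 1 →
    g * .xa i = .xa i * g → g = 1 := by decide +kernel
  exact h

theorem isIrreducible_quaternionRep {G : Type*} [Group G] (ρ : G →* QuaternionGroup 5)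
    {k : QuaternionGroup 5} {x y : G} (hx : ρ x = k * .xa 0 * k⁻¹) (hy : ρ y = k * .xa 2 * k⁻¹) :
    (linearRep (quaternionRep.comp ρ)).IsIrreducible := by
  -- The indices change under conjugation, but their doubles stay distinct mod 10.
  have h : ∀ k : QuaternionGroup 5, ∃ i j, k * .xa 0 * k⁻¹ = .xa i ∧
      k * .xa 2 * k⁻¹ = .xa j ∧ i + i ≠ j + j := by decide +kernel
  obtain ⟨i, j, hi, hj, hij⟩ := h k
  refine isIrreducible_linearRep _ x y fun v c d hc hd => ?_
  rw [MonoidHom.comp_apply, hx, hi] at hc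
  rw [MonoidHom.comp_apply, hy, hj] at hd
  have h1 := quaternionRep_eigenvector hc
  have h2 := quaternionRep_eigenvector hd
  have h3 : ZMod.stdAddChar (i + i) - ZMod.stdAddChar (j + j) ≠ (0 : ℂ) :=
    sub_ne_zero.2 fun e => hij (ZMod.injective_stdAddChar e)
  have h4 : (ZMod.stdAddChar (i + i) - ZMod.stdAddChar (j + j)) * v 0 ^ 2 = 0 := by
    rw [sub_mul, h1, h2, sub_self]
  have h5 : v 0 = 0 := by simpa [h3] using h4
  have h6 : v 1 = 0 := by simpa [h5] using h1
  ext k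
  fin_cases k
  · exact h5
  · exact h6

/-! ### Triangular case: longitude, trace, infinite non-abelian image -/

namespace Triangular

theorem diag_of_isConj {m : Triangular} (hm : IsConj ⟨golden, 0⟩ m ∨ IsConj ⟨golden, 0⟩⁻¹ m) :
    m.diag = golden ∨ m.diag = golden⁻¹ := by
  rcases hm with h | h
  · exact .inl (isConj_iff_eq.1 (character.map_isConj h)).symm
  · exact .inr (isConj_iff_eq.1 (character.map_isConj h)).symm

/-- Conjugation by `m` scales the corner entry of a unipotent element by `m.diag ^ 2`, which is φ²
or φ⁻² and so different from 1. -/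
theorem eq_one_of_commute {l m : Triangular} (h1 : l.diag = 1) (h : Commute l m)
    (hm : m.diag = golden ∨ m.diag = golden⁻¹) : l = 1 := by
  have h2 := congrArg off h.eq
  simp only [mul_off, h1, Units.val_one, one_mul, inv_one, mul_one] at h2
  have h3 : m.diag ^ 2 ≠ 1 := by
    rcases hm with hm | hm
    · rw [hm]; exact golden_pow_ne_one two_ne_zero
    · rw [hm, inv_pow, Ne, inv_eq_one]; exact golden_pow_ne_one two_ne_zero
  have h4 : ((m.diag : ℂ) ^ 2 - 1) * l.off = 0 := by
    have := m.diag.mul_inv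
    linear_combination (-(m.diag : ℂ)) * h2 + l.off * this
  have h5 : (m.diag : ℂ) ^ 2 - 1 ≠ 0 := by
    rw [sub_ne_zero]
    exact fun e => h3 (Units.ext (by simpa using e))
  exact Triangular.ext h1 ((mul_eq_zero.1 h4).resolve_left h5)

theorem trace_toSL_of_diag {m : Triangular} (hm : m.diag = golden ∨ m.diag = golden⁻¹) :
    trace (toSL m : Matrix (Fin 2) (Fin 2) ℂ) = ((Real.sqrt 5 : ℝ) : ℂ) := by
  rw [trace_toSL, ← golden_add_inv]
  rcases hm with h | h <;> rw [h]
  rw [inv_inv, add_comm]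

theorem not_isOfFinOrder_conj (k : Triangular) : ¬ IsOfFinOrder (k * ⟨golden, 0⟩ * k⁻¹) := by
  intro h
  have h2 := character.isOfFinOrder h
  rw [map_mul, map_mul, map_inv, mul_inv_cancel_comm] at h2
  exact not_isOfFinOrder_golden h2

theorem not_commute : (⟨golden, 0⟩ : Triangular) * ⟨golden, 1⟩ ≠ ⟨golden, 1⟩ * ⟨golden, 0⟩ := by
  intro h
  have h3 : (golden : ℂ) = (golden⁻¹ : ℂˣ) := by simpa using congrArg off h
  refine golden_pow_ne_one two_ne_zero ?_
  rw [sq]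
  nth_rw 1 [Units.ext h3]
  exact inv_mul_cancel _

theorem infinite_range {G : Type*} [Group G] (ρ : G →* Triangular) {k : Triangular} {x : G}
    (hx : ρ x = k * ⟨golden, 0⟩ * k⁻¹) : Infinite (toSL.comp ρ).range := by
  refine Infinite.of_injective (fun n : ℕ => (toSL.comp ρ).rangeRestrict (x ^ n)) fun m n h => ?_
  have h1 : (toSL.comp ρ) (x ^ m) = (toSL.comp ρ) (x ^ n) := congrArg Subtype.val h
  rw [MonoidHom.comp_apply, MonoidHom.comp_apply] at h1
  have h2 := toSL_injective h1
  rw [map_pow, map_pow, hx] at h2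
  exact injective_pow_iff_not_isOfFinOrder.2 (not_isOfFinOrder_conj k) h2

theorem infinite_of_apply {G : Type*} [Group G] (ρ : G →* Triangular) {k : Triangular} {x : G}
    (hx : ρ x = k * ⟨golden, 0⟩ * k⁻¹) : Infinite G := by
  rw [← not_finite_iff_infinite]
  intro hfin
  have h1 := ρ.isOfFinOrder (isOfFinOrder_of_finite x)
  rw [hx] at h1
  exact not_isOfFinOrder_conj k h1

theorem exists_mul_ne {G : Type*} [Group G] (ρ : G →* Triangular) {k : Triangular} {x y : G}
    (hx : ρ x = k * ⟨golden, 0⟩ * k⁻¹) (hy : ρ y = k * ⟨golden, 1⟩ * k⁻¹) :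
    ∃ a b : G, a * b ≠ b * a := by
  refine ⟨x, y, fun h => not_commute ?_⟩
  have h1 := congrArg ρ h
  rw [map_mul, map_mul, hx, hy] at h1
  simpa using h1

end Triangular

end KnotSurgery

end

open KnotSurgery in
theorem proposition4p10 (N : TubularNbhd figureEightKnot) (hN : N.IsZeroFramed) :
    (∃ ρ : N.knotGroup →* Matrix.SpecialLinearGroup (Fin 2) ℂ,
      (linearRep ρ).IsIrreducible ∧
      Matrix.trace (ρ N.meridian : Matrix (Fin 2) (Fin 2) ℂ) = 0 ∧
      ρ N.longitude = 1) ∧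
    (∃ ρ : N.knotGroup →* Matrix.SpecialLinearGroup (Fin 2) ℂ,
      Matrix.trace (ρ N.meridian : Matrix (Fin 2) (Fin 2) ℂ) = ((Real.sqrt 5 : ℝ) : ℂ) ∧
      ρ N.longitude = 1 ∧
      Infinite ρ.range) ∧
    (∀ x : N.Surgery,
      (∃ a b : FundamentalGroup N.Surgery x, a * b ≠ b * a) ∧
      Infinite (FundamentalGroup N.Surgery x)) := by
  constructor
  · obtain ⟨ρ, hc, hm, ⟨k, x, y, hx, hy⟩, -⟩ := N.exists_hom (G := QuaternionGroup 5) (.xa 0) (.xa 2)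
      quaternion_relation
    obtain ⟨i, hi⟩ := quaternion_of_isConj hm
    rw [hi] at hc
    refine ⟨quaternionRep.comp ρ, isIrreducible_quaternionRep ρ hx hy, ?_, ?_⟩
    · rw [MonoidHom.comp_apply, hi]
      change Matrix.trace !![0, -ZMod.stdAddChar (-i); ZMod.stdAddChar i, (0 : ℂ)] = 0
      simp [Matrix.trace_fin_two]
    · rw [MonoidHom.comp_apply,
        quaternion_eq_one _ i (hN.map_longitude (quaternionChar.comp ρ)) hc, map_one]
  -- The same triangular pair serves the trace √5 representation and, through `hs`, the group of the
  -- surgery.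
  · obtain ⟨ρ, hc, hm, ⟨k, x, y, hx, hy⟩, hs⟩ := N.exists_hom _ _ Triangular.relation
    have hd := Triangular.diag_of_isConj hm
    have hl : ρ N.longitude = 1 :=
      Triangular.eq_one_of_commute (hN.map_longitude (Triangular.character.comp ρ)) hc hd
    refine ⟨⟨Triangular.toSL.comp ρ, Triangular.trace_toSL_of_diag hd, ?_,
      Triangular.infinite_range ρ hx⟩, fun x => ?_⟩
    · rw [MonoidHom.comp_apply, hl, map_one]
    · obtain ⟨ψ, k, y, z, hy, hz⟩ := hs hl x
      exact ⟨Triangular.exists_mul_ne ψ hy hz, Triangular.infinite_of_apply ψ hy⟩
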